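/- Let $F$ be a field of arbitrary characteristic, $M_2=M_2(F)$ with matrix units $e_{ij}$, and let $a\mapsto\bar a$ be the symplectic involution of $M_2$ (the adjugate matrix). Let $\mathrm{Reg}$ be the regular $M_2$-bimodule $M_2$, and let $\mathrm{Cay}=Fm_1+Fm_2$ be the alternative $M_2$-bimodule with $e_{ij}\cdot m_k=\delta_{ik}m_j$ and $m\cdot a=\bar a\cdot m$. Let $B(4,2)=M_2\oplus\mathrm{Cay}$ be the $\mathbb Z_2$-graded algebra with even part $M_2$ and odd part $\mathrm{Cay}$, in which $M_2$ multiplies as usual and acts on $\mathrm{Cay}$ as above, and $$m_1^2=e_{21},\quad m_2^2=-e_{12},\quad m_1m_2=-e_{11},\quad m_2m_1=e_{22}.$$ A $\Gamma$-algebra is a unital (not necessarily associative) $\mathbb Z_2$-graded $F$-algebra $\Gamma=\Gamma_0\oplus\Gamma_1$ such that (i) $\Gamma_0$ is a unital associative algebra and $[\Gamma_0,\Gamma_1]=(\Gamma_0,\Gamma,\Gamma)=0$; (ii) $\Gamma_1^2\subseteq Z(\Gamma_0)$; (iii) $xy+yx=0$ and $x^2=0$ for $x,y\in\Gamma_1$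 (the second condition follows from the first if $\operatorname{char}F\neq2$); (iv) $(xy)z+(yz)x+(zx)y=0$ for $x,y,z\in\Gamma_1$. Its $B(4,2)$-envelope is the algebra $\Gamma(B(4,2))=\Gamma_0\otimes M_2+\Gamma_1\otimes\mathrm{Cay}\subseteq\Gamma\otimes_F B(4,2)$. For an alternative algebra $A$ and an alternative $A$-bimodule $V$, the tensor algebra $A[V]$ is the quotient of the free alternative algebra on the vector space $A\oplus V$, with product $*$, by the ideal generated by all $a*b-ab$, $a*v-a\cdot v$, $v*a-v\cdot a$ with $a,b\in A$, $v\in V$. Let $X_0,X_1$ be arbitrary sets and let $\Gamma[X_0,X_1]$ be the free $\Gamma$-algebra on the set $X_0$ of even generators and the set $X_1$ of odd generators. Let $V=\mathrm{Reg}^{\#X_0}\oplus\mathrm{Cay}^{\#X_1}$, the direct sum of $\#X_0$ copies of $\mathrm{Reg}$ and $\#X_1$ copies of $\mathrm{Cay}$. Then $$\Gamma[X_0,X_1](B(4,2))\cong M_2[V]$$ as $M_2$-algebras, that is, there is an isomorphism of $F$-algebras that sends $1\otimes a$ to the image of $a$ in $M_2[V]$ for every $a\in M_2$. -/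

import Mathlib

open scoped TensorProduct

noncomputable section

namespace GammaAlg

/-! ### Quotients of (not necessarily associative) algebras by ideals -/

section Quotient

/-- The two-sided ideal of the `F`-algebra `A` generated by the set `S`: the smallest subspace
that contains `S` and is closed under left and right multiplication by elements of `A`. -/
def idealSpan (F : Type*) [Field F] {A : Type*} [NonUnitalNonAssocRing A] [Module F A]
    (S : Set A) : Submodule F A :=
  sInf {I | S ⊆ I ∧ ∀ a : A, ∀ x ∈ I, a * x ∈ I ∧ x * a ∈ I}

variable {F : Type*} [Field F] {A : Type*} [NonUnitalNonAssocRing A] [Module F A]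

theorem subset_idealSpan (S : Set A) : S ⊆ idealSpan F S := by
  intro x hx
  simp only [idealSpan, SetLike.mem_coe, Submodule.mem_sInf]
  exact fun I hI => hI.1 hx

theorem idealSpan_le {S : Set A} {I : Submodule F A} (h : S ⊆ I)
    (hI : ∀ a : A, ∀ x ∈ I, a * x ∈ I ∧ x * a ∈ I) : idealSpan F S ≤ I :=
  sInf_le ⟨h, hI⟩

theorem mul_mem_idealSpan {S : Set A} (a : A) {x : A} (hx : x ∈ idealSpan F S) :
    a * x ∈ idealSpan F S := by
  simp only [idealSpan, Submodule.mem_sInf] at hx ⊢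
  exact fun I hI => (hI.2 a x (hx I hI)).1

theorem idealSpan_mul_mem {S : Set A} (a : A) {x : A} (hx : x ∈ idealSpan F S) :
    x * a ∈ idealSpan F S := by
  simp only [idealSpan, Submodule.mem_sInf] at hx ⊢
  exact fun I hI => (hI.2 a x (hx I hI)).2

variable (F) in
/-- The quotient of the `F`-algebra `A` by the ideal generated by `S`. -/
def AlgQuot (S : Set A) : Type _ := A ⧸ idealSpan F S

namespace AlgQuot

variable (S : Set A)

instance : AddCommGroup (AlgQuot F S) := inferInstanceAs (AddCommGroup (A ⧸ idealSpan F S))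

instance : Module F (AlgQuot F S) := inferInstanceAs (Module F (A ⧸ idealSpan F S))

variable (F) in
/-- The canonical projection, as a linear map. -/
def mkₗ : A →ₗ[F] AlgQuot F S := (idealSpan F S).mkQ

theorem mkₗ_surjective : Function.Surjective (mkₗ F S) := Submodule.mkQ_surjective _

theorem mkₗ_eq_iff {x y : A} : mkₗ F S x = mkₗ F S y ↔ x - y ∈ idealSpan F S :=
  Submodule.Quotient.eq _

theorem mkₗ_eq_zero_iff {x : A} : mkₗ F S x = 0 ↔ x ∈ idealSpan F S :=
  Submodule.Quotient.mk_eq_zero _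

instance : Mul (AlgQuot F S) where
  mul x y := Quotient.liftOn₂' x y (fun a b => mkₗ F S (a * b)) (by
    intro a b a' b' h h'
    rw [Submodule.quotientRel_def] at h h'
    refine (mkₗ_eq_iff S).2 ?_
    have : a * b - a' * b' = (a - a') * b + a' * (b - b') := by noncomm_ring
    rw [this]
    exact add_mem (idealSpan_mul_mem _ h) (mul_mem_idealSpan _ h'))

theorem mkₗ_mul (a b : A) : mkₗ F S (a * b) = mkₗ F S a * mkₗ F S b := rfl

instance : NonUnitalNonAssocRing (AlgQuot F S) where
  left_distrib x y z := by
    obtain ⟨a, rfl⟩ := mkₗ_surjective S x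
    obtain ⟨b, rfl⟩ := mkₗ_surjective S y
    obtain ⟨c, rfl⟩ := mkₗ_surjective S z
    simp only [← map_add, ← mkₗ_mul, mul_add]
  right_distrib x y z := by
    obtain ⟨a, rfl⟩ := mkₗ_surjective S x
    obtain ⟨b, rfl⟩ := mkₗ_surjective S y
    obtain ⟨c, rfl⟩ := mkₗ_surjective S z
    simp only [← map_add, ← mkₗ_mul, add_mul]
  zero_mul x := by
    obtain ⟨a, rfl⟩ := mkₗ_surjective S x
    rw [← map_zero (mkₗ F S), ← mkₗ_mul, zero_mul]
  mul_zero x := by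
    obtain ⟨a, rfl⟩ := mkₗ_surjective S x
    rw [← map_zero (mkₗ F S), ← mkₗ_mul, mul_zero]

instance [IsScalarTower F A A] : IsScalarTower F (AlgQuot F S) (AlgQuot F S) where
  smul_assoc c x y := by
    obtain ⟨a, rfl⟩ := mkₗ_surjective S x
    obtain ⟨b, rfl⟩ := mkₗ_surjective S y
    simp only [smul_eq_mul, ← map_smul, ← mkₗ_mul, smul_mul_assoc]

instance [SMulCommClass F A A] : SMulCommClass F (AlgQuot F S) (AlgQuot F S) where
  smul_comm c x y := by
    obtain ⟨a, rfl⟩ := mkₗ_surjective S x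
    obtain ⟨b, rfl⟩ := mkₗ_surjective S y
    simp only [smul_eq_mul, ← map_smul, ← mkₗ_mul, mul_smul_comm]

variable (F) in
/-- The canonical projection, as a homomorphism of algebras. -/
def mk : A →ₙₐ[F] AlgQuot F S where
  toFun := mkₗ F S
  map_smul' := map_smul (mkₗ F S)
  map_zero' := map_zero (mkₗ F S)
  map_add' := map_add (mkₗ F S)
  map_mul' := mkₗ_mul S

variable {S} in
/-- A homomorphism that vanishes on `S` factors through the quotient. -/
def lift {B : Type*} [NonUnitalNonAssocRing B] [Module F B] (f : A →ₙₐ[F] B)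
    (h : ∀ s ∈ S, f s = 0) : AlgQuot F S →ₙₐ[F] B :=
  let f' : AlgQuot F S →ₗ[F] B := (idealSpan F S).liftQ (f : A →ₗ[F] B)
    (idealSpan_le (fun s hs => h s hs) (fun a x hx => by
      have hx : f x = 0 := hx
      constructor
      · change f (a * x) = 0
        rw [map_mul, hx, mul_zero]
      · change f (x * a) = 0
        rw [map_mul, hx, zero_mul]))
  { toFun := f'
    map_smul' := map_smul f'
    map_zero' := map_zero f'
    map_add' := map_add f'
    map_mul' := fun x y => by
      obtain ⟨a, rfl⟩ := mkₗ_surjective S x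
      obtain ⟨b, rfl⟩ := mkₗ_surjective S y
      exact map_mul f a b }

end AlgQuot

instance AlgQuot.instNonAssocRing {U : Type*} [NonAssocRing U] [Module F U] (S : Set U) :
    NonAssocRing (AlgQuot F S) where
  one := AlgQuot.mkₗ F S 1
  one_mul x := by
    obtain ⟨a, rfl⟩ := AlgQuot.mkₗ_surjective S x
    exact congrArg (AlgQuot.mkₗ F S) (one_mul a)
  mul_one x := by
    obtain ⟨a, rfl⟩ := AlgQuot.mkₗ_surjective S x
    exact congrArg (AlgQuot.mkₗ F S) (mul_one a)

end Quotient

/-! ### Superalgebras and graded envelopes -/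

/-- `A = 𝒜 0 ⊕ 𝒜 1` is a `ℤ/2`-graded algebra (a superalgebra). -/
structure IsSuperalgebra {F : Type*} [Field F] {A : Type*} [NonUnitalNonAssocRing A] [Module F A]
    (𝒜 : ZMod 2 → Submodule F A) : Prop where
  isCompl : IsCompl (𝒜 0) (𝒜 1)
  mul_mem : ∀ {i j : ZMod 2} {x y : A}, x ∈ 𝒜 i → y ∈ 𝒜 j → x * y ∈ 𝒜 (i + j)

section Envelope

variable {F : Type*} [Field F]
  {A : Type*} [NonUnitalNonAssocRing A] [Module F A] [IsScalarTower F A A] [SMulCommClass F A A]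
  {B : Type*} [NonUnitalNonAssocRing B] [Module F B] [IsScalarTower F B B] [SMulCommClass F B B]

/-- The `A`-envelope `A₀ ⊗ B₀ + A₁ ⊗ B₁` of the superalgebra `B`, a subalgebra of `A ⊗ B` with the
multiplication `(a ⊗ b) (a' ⊗ b') = a a' ⊗ b b'`. -/
def envelope {𝒜 : ZMod 2 → Submodule F A} {ℬ : ZMod 2 → Submodule F B}
    (hA : IsSuperalgebra 𝒜) (hB : IsSuperalgebra ℬ) : NonUnitalSubalgebra F (A ⊗[F] B) where
  __ := (⨆ i : ZMod 2, Submodule.map₂ (TensorProduct.mk F A B) (𝒜 i) (ℬ i) :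
    Submodule F (A ⊗[F] B))
  mul_mem' {x y} hx hy := by
    set E : Submodule F (A ⊗[F] B) :=
      ⨆ i : ZMod 2, Submodule.map₂ (TensorProduct.mk F A B) (𝒜 i) (ℬ i) with hE
    have key : Submodule.map₂ (LinearMap.mul F (A ⊗[F] B)) E E ≤ E := by
      rw [hE, Submodule.map₂_iSup_left]
      refine iSup_le fun i => ?_
      rw [Submodule.map₂_iSup_right]
      refine iSup_le fun j => ?_
      refine Submodule.map₂_le.2 fun x hx y hy => ?_
      have h1 : Submodule.map₂ (TensorProduct.mk F A B) (𝒜 i) (ℬ i) ≤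
          E.comap ((LinearMap.mul F (A ⊗[F] B)).flip y) := by
        refine Submodule.map₂_le.2 fun a ha b hb => ?_
        have h2 : Submodule.map₂ (TensorProduct.mk F A B) (𝒜 j) (ℬ j) ≤
            E.comap (LinearMap.mul F (A ⊗[F] B) (a ⊗ₜ[F] b)) := by
          refine Submodule.map₂_le.2 fun c hc d hd => ?_
          have : (a * c) ⊗ₜ[F] (b * d) ∈ E :=
            le_iSup (fun i : ZMod 2 => Submodule.map₂ (TensorProduct.mk F A B) (𝒜 i) (ℬ i)) (i + j)
              (Submodule.apply_mem_map₂ (TensorProduct.mk F A B)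
                (hA.mul_mem ha hc) (hB.mul_mem hb hd))
          simpa using this
        exact h2 hy
      exact h1 hx
    exact key (Submodule.apply_mem_map₂ (LinearMap.mul F (A ⊗[F] B)) hx hy)

theorem tmul_mem_envelope {𝒜 : ZMod 2 → Submodule F A} {ℬ : ZMod 2 → Submodule F B}
    (hA : IsSuperalgebra 𝒜) (hB : IsSuperalgebra ℬ) {i : ZMod 2} {a : A} {b : B}
    (ha : a ∈ 𝒜 i) (hb : b ∈ ℬ i) : a ⊗ₜ[F] b ∈ envelope hA hB :=
  le_iSup (fun i : ZMod 2 => Submodule.map₂ (TensorProduct.mk F A B) (𝒜 i) (ℬ i)) i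
    (Submodule.apply_mem_map₂ (TensorProduct.mk F A B) ha hb)

end Envelope

/-! ### The superalgebra `B(4,2)` -/

section B42

/-- `M₂(F)`. -/
abbrev M2 (F : Type*) : Type _ := Matrix (Fin 2) (Fin 2) F

/-- The underlying space `M₂(F) ⊕ Cay` of `B(4,2)`; a pair `(c 0, c 1)` in the second summand is
the vector `c 0 • m₁ + c 1 • m₂` of `Cay`. -/
@[ext]
structure B42 (F : Type*) where
  even : M2 F
  odd : Fin 2 → F

variable (F : Type*) [Field F]

/-- `B(4,2)` as a vector space is the product. -/
def B42.equivProd : B42 F ≃ M2 F × (Fin 2 → F) where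
  toFun x := (x.even, x.odd)
  invFun x := ⟨x.1, x.2⟩

instance : AddCommGroup (B42 F) := (B42.equivProd F).addCommGroup

instance : Module F (B42 F) := (B42.equivProd F).module F

/-- The product of two vectors of `Cay` in `B(4,2)`, with
`m₁ m₁ = e₂₁`, `m₂ m₂ = - e₁₂`, `m₁ m₂ = - e₁₁`, `m₂ m₁ = e₂₂`. -/
def cayMul (m n : Fin 2 → F) : M2 F :=
  !![-(m 0 * n 1), -(m 1 * n 1); m 0 * n 0, m 1 * n 0]

/-- The multiplication of `B(4,2)`. The actions of `M₂(F)` on `Cay` are given by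
`eᵢⱼ · mₖ = δᵢₖ mⱼ` and `m · a = ā · m`, where `ā` is the symplectic involution, that is, the
adjugate matrix of `a`. -/
instance : Mul (B42 F) where
  mul x y := ⟨x.even * y.even + cayMul F x.odd y.odd,
    Matrix.vecMul y.odd x.even + Matrix.vecMul x.odd y.even.adjugate⟩

instance : One (B42 F) where
  one := ⟨1, 0⟩

namespace B42

variable {F}

@[simp] theorem even_zero : (0 : B42 F).even = 0 := rfl
@[simp] theorem odd_zero : (0 : B42 F).odd = 0 := rfl
@[simp] theorem even_one : (1 : B42 F).even = 1 := rfl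
@[simp] theorem odd_one : (1 : B42 F).odd = 0 := rfl
@[simp] theorem even_add (x y : B42 F) : (x + y).even = x.even + y.even := rfl
@[simp] theorem odd_add (x y : B42 F) : (x + y).odd = x.odd + y.odd := rfl
@[simp] theorem even_smul (c : F) (x : B42 F) : (c • x).even = c • x.even := rfl
@[simp] theorem odd_smul (c : F) (x : B42 F) : (c • x).odd = c • x.odd := rfl
@[simp] theorem even_mul (x y : B42 F) :
    (x * y).even = x.even * y.even + cayMul F x.odd y.odd := rfl
@[simp] theorem odd_mul (x y : B42 F) : (x * y).odd =
    Matrix.vecMul y.odd x.even + Matrix.vecMul x.odd y.even.adjugate := rfl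

theorem adjugate_add (a b : M2 F) : (a + b).adjugate = a.adjugate + b.adjugate := by
  simp only [Matrix.adjugate_fin_two]
  ext i j
  fin_cases i <;> fin_cases j <;> simp [add_comm]

theorem adjugate_smul (c : F) (a : M2 F) : (c • a).adjugate = c • a.adjugate := by
  simp only [Matrix.adjugate_fin_two]
  ext i j
  fin_cases i <;> fin_cases j <;> simp

instance : NonAssocRing (B42 F) where
  left_distrib x y z := by
    ext i j
    · fin_cases i <;> fin_cases j <;> simp [cayMul, mul_add] <;> ring
    · simp [adjugate_add, Matrix.add_vecMul, Matrix.vecMul_add]; ring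
  right_distrib x y z := by
    ext i j
    · fin_cases i <;> fin_cases j <;> simp [cayMul, add_mul] <;> ring
    · simp [Matrix.add_vecMul, Matrix.vecMul_add]; ring
  zero_mul x := by
    ext i j
    · fin_cases i <;> fin_cases j <;> simp [cayMul]
    · simp
  mul_zero x := by
    ext i j
    · fin_cases i <;> fin_cases j <;> simp [cayMul]
    · simp
  one_mul x := by
    ext i j
    · fin_cases i <;> fin_cases j <;> simp [cayMul]
    · simp
  mul_one x := by
    ext i j
    · fin_cases i <;> fin_cases j <;> simp [cayMul]
    · simp

instance : IsScalarTower F (B42 F) (B42 F) where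
  smul_assoc c x y := by
    ext i j
    · fin_cases i <;> fin_cases j <;> simp [cayMul] <;> ring
    · simp [Matrix.vecMul_smul, Matrix.smul_vecMul]; ring

instance : SMulCommClass F (B42 F) (B42 F) where
  smul_comm c x y := by
    ext i j
    · fin_cases i <;> fin_cases j <;> simp [cayMul] <;> ring
    · simp [Matrix.vecMul_smul, Matrix.smul_vecMul, adjugate_smul]; ring

variable (F) in
/-- The grading of `B(4,2)`: the even part is `M₂(F)`, the odd part is `Cay`. -/
def grading (i : ZMod 2) : Submodule F (B42 F) where
  carrier := {x | (i = 0 → x.odd = 0) ∧ (i = 1 → x.even = 0)}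
  zero_mem' := by simp
  add_mem' {x y} hx hy := by
    refine ⟨fun h => ?_, fun h => ?_⟩
    · simp [hx.1 h, hy.1 h]
    · simp [hx.2 h, hy.2 h]
  smul_mem' c x hx := by
    refine ⟨fun h => ?_, fun h => ?_⟩
    · simp [hx.1 h]
    · simp [hx.2 h]

theorem mem_grading_zero {x : B42 F} : x ∈ grading F 0 ↔ x.odd = 0 := by
  change ((0 : ZMod 2) = 0 → x.odd = 0) ∧ ((0 : ZMod 2) = 1 → x.even = 0) ↔ _
  simp

theorem mem_grading_one {x : B42 F} : x ∈ grading F 1 ↔ x.even = 0 := by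
  change ((1 : ZMod 2) = 0 → x.odd = 0) ∧ ((1 : ZMod 2) = 1 → x.even = 0) ↔ _
  simp

theorem isSuperalgebra : IsSuperalgebra (grading F) where
  isCompl := by
    constructor
    · rw [Submodule.disjoint_def]
      intro x h0 h1
      exact B42.ext (mem_grading_one.1 h1) (mem_grading_zero.1 h0)
    · rw [codisjoint_iff, eq_top_iff]
      intro x _
      refine Submodule.mem_sup.2 ⟨⟨x.even, 0⟩, mem_grading_zero.2 rfl, ⟨0, x.odd⟩,
        mem_grading_one.2 rfl, ?_⟩
      ext <;> simp
  mul_mem {i j x y} hx hy := by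
    fin_cases i <;> fin_cases j
    · have hx := mem_grading_zero.1 hx
      have hy := mem_grading_zero.1 hy
      exact mem_grading_zero.2 (by simp [hx, hy])
    · have hx := mem_grading_zero.1 hx
      have hy := mem_grading_one.1 hy
      refine mem_grading_one.2 ?_
      ext i j
      fin_cases i <;> fin_cases j <;> simp [hx, hy, cayMul]
    · have hx := mem_grading_one.1 hx
      have hy := mem_grading_zero.1 hy
      refine mem_grading_one.2 ?_
      ext i j
      fin_cases i <;> fin_cases j <;> simp [hx, hy, cayMul]
    · have hx := mem_grading_one.1 hx
      have hy := mem_grading_one.1 hy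
      refine mem_grading_zero.2 ?_
      have : (0 : M2 F).adjugate = 0 := by simp
      simp [hx, hy, this]

end B42

end B42

/-! ### `Γ`-algebras -/

/-- A `Γ`-algebra: a unital `ℤ/2`-graded algebra `Γ = Γ₀ ⊕ Γ₁` such that
(i) `Γ₀` is a unital associative algebra and `[Γ₀, Γ₁] = (Γ₀, Γ, Γ) = 0`;
(ii) `Γ₁² ⊆ Z(Γ₀)`;
(iii) the product of odd elements is skew-symmetric;
(iv) `(x y) z + (y z) x + (z x) y = 0` for odd `x, y, z`.
In (iii) `x * x = 0` follows from `x * y + y * x = 0` outside characteristic 2. -/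
structure IsGammaAlgebra {F : Type*} [Field F] {Γ : Type*} [NonAssocRing Γ] [Module F Γ]
    (𝒢 : ZMod 2 → Submodule F Γ) : Prop extends IsSuperalgebra 𝒢 where
  one_mem : (1 : Γ) ∈ 𝒢 0
  comm : ∀ a ∈ 𝒢 0, ∀ x ∈ 𝒢 1, a * x = x * a
  assoc : ∀ a ∈ 𝒢 0, ∀ b c : Γ, (a * b) * c = a * (b * c)
  center : ∀ x ∈ 𝒢 1, ∀ y ∈ 𝒢 1, ∀ a ∈ 𝒢 0, (x * y) * a = a * (x * y)
  skew : ∀ x ∈ 𝒢 1, ∀ y ∈ 𝒢 1, x * y + y * x = 0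
  sq_zero : ∀ x ∈ 𝒢 1, x * x = 0
  cyclic : ∀ x ∈ 𝒢 1, ∀ y ∈ 𝒢 1, ∀ z ∈ 𝒢 1, (x * y) * z + (y * z) * x + (z * x) * y = 0

section FreeGamma

variable (F : Type*) [Field F] (X₀ X₁ : Type*)

/-- The nonassociative words, including the empty one, in even letters `X₀` and odd letters
`X₁`. -/
abbrev Word : Type _ := WithOne (FreeMagma (X₀ ⊕ X₁))

/-- The free unital nonassociative algebra on `X₀ ⊔ X₁`, with basis the nonassociative words. -/
abbrev FreeNonassoc : Type _ := MonoidAlgebra F (Word X₀ X₁)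

variable {X₀ X₁} in
/-- The parity of a word: the number of its odd letters modulo 2. -/
def parity : Word X₀ X₁ →* Multiplicative (ZMod 2) :=
  WithOne.lift (FreeMagma.lift (Sum.elim (fun _ => Multiplicative.ofAdd 0)
    (fun _ => Multiplicative.ofAdd 1)))

/-- The even and odd parts of the free unital nonassociative algebra. -/
def freeGrading (i : ZMod 2) : Submodule F (FreeNonassoc F X₀ X₁) :=
  MonoidAlgebra.supported F F {w | parity w = Multiplicative.ofAdd i}

variable {X₀ X₁} in
/-- The left-hand sides of the defining identities of `Γ`-algebras, evaluated at all homogeneous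
elements of the free unital nonassociative algebra. -/
inductive GammaRel : FreeNonassoc F X₀ X₁ → Prop
  | comm (a x) (ha : a ∈ freeGrading F X₀ X₁ 0) (hx : x ∈ freeGrading F X₀ X₁ 1) :
      GammaRel (a * x - x * a)
  | assoc (i j : ZMod 2) (a b c) (ha : a ∈ freeGrading F X₀ X₁ 0)
      (hb : b ∈ freeGrading F X₀ X₁ i) (hc : c ∈ freeGrading F X₀ X₁ j) :
      GammaRel ((a * b) * c - a * (b * c))
  | center (x y a) (hx : x ∈ freeGrading F X₀ X₁ 1) (hy : y ∈ freeGrading F X₀ X₁ 1)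
      (ha : a ∈ freeGrading F X₀ X₁ 0) : GammaRel ((x * y) * a - a * (x * y))
  | skew (x y) (hx : x ∈ freeGrading F X₀ X₁ 1) (hy : y ∈ freeGrading F X₀ X₁ 1) :
      GammaRel (x * y + y * x)
  | sq_zero (x) (hx : x ∈ freeGrading F X₀ X₁ 1) : GammaRel (x * x)
  | cyclic (x y z) (hx : x ∈ freeGrading F X₀ X₁ 1) (hy : y ∈ freeGrading F X₀ X₁ 1)
      (hz : z ∈ freeGrading F X₀ X₁ 1) : GammaRel ((x * y) * z + (y * z) * x + (z * x) * y)

/-- The free `Γ`-algebra `Γ[X₀, X₁]` on even generators `X₀` and odd generators `X₁`. -/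
abbrev FreeGamma : Type _ := AlgQuot F {r : FreeNonassoc F X₀ X₁ | GammaRel F r}

namespace FreeGamma

/-- The grading of the free `Γ`-algebra. -/
def grading (i : ZMod 2) : Submodule F (FreeGamma F X₀ X₁) :=
  (freeGrading F X₀ X₁ i).map (AlgQuot.mkₗ F _)

variable {F X₀ X₁}

/-- The even generators. -/
def ofEven (x : X₀) : FreeGamma F X₀ X₁ :=
  AlgQuot.mkₗ F _ (MonoidAlgebra.single (WithOne.coe (FreeMagma.of (Sum.inl x))) 1)

/-- The odd generators. -/
def ofOdd (x : X₁) : FreeGamma F X₀ X₁ :=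
  AlgQuot.mkₗ F _ (MonoidAlgebra.single (WithOne.coe (FreeMagma.of (Sum.inr x))) 1)

end FreeGamma

variable {F X₀ X₁}

theorem freeGrading_isSuperalgebra : IsSuperalgebra (freeGrading F X₀ X₁) where
  isCompl := by
    constructor
    · rw [Submodule.disjoint_def]
      intro x h0 h1
      rw [freeGrading, MonoidAlgebra.mem_supported'] at h0 h1
      ext w
      by_cases hw : parity w = Multiplicative.ofAdd (0 : ZMod 2)
      · refine h1 w ?_
        simp only [Set.mem_ofPred_eq, hw]
        decide
      · exact h0 w hw
    · rw [codisjoint_iff, eq_top_iff]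
      intro x _
      induction x using MonoidAlgebra.induction_linear with
      | zero => exact zero_mem _
      | add f g hf hg => exact add_mem (hf trivial) (hg trivial)
      | single w c =>
        have key : ∀ p : ZMod 2, p = 0 ∨ p = 1 := by decide
        have hs : ∀ p : ZMod 2, parity w = Multiplicative.ofAdd p →
            MonoidAlgebra.single w c ∈ freeGrading F X₀ X₁ p := by
          intro p hp
          rw [freeGrading, MonoidAlgebra.mem_supported']
          intro m hm
          classical
          rw [MonoidAlgebra.coeff_single, Finsupp.single_apply, if_neg]
          rintro rfl
          exact hm hp
        rcases key (Multiplicative.toAdd (parity w)) with h | h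
        · exact Submodule.mem_sup_left (hs 0 (by rw [← h]; rfl))
        · exact Submodule.mem_sup_right (hs 1 (by rw [← h]; rfl))
  mul_mem {i j x y} hx hy := by
    have hm : Submodule.map₂ (LinearMap.mul F (FreeNonassoc F X₀ X₁))
        (freeGrading F X₀ X₁ i) (freeGrading F X₀ X₁ j) ≤ freeGrading F X₀ X₁ (i + j) := by
      simp only [freeGrading]
      rw [MonoidAlgebra.supported_eq_span_single, MonoidAlgebra.supported_eq_span_single,
        Submodule.map₂_span_span, Submodule.span_le]
      rintro _ ⟨_, ⟨v, hv, rfl⟩, _, ⟨w, hw, rfl⟩, rfl⟩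
      simp only [LinearMap.mul_apply', MonoidAlgebra.single_mul_single, mul_one, SetLike.mem_coe]
      rw [MonoidAlgebra.supported_eq_span_single]
      refine Submodule.subset_span ⟨v * w, ?_, rfl⟩
      simp only [Set.mem_ofPred_eq] at hv hw ⊢
      rw [map_mul, hv, hw, ofAdd_add]
    exact hm (Submodule.apply_mem_map₂ (LinearMap.mul F (FreeNonassoc F X₀ X₁)) hx hy)

theorem one_mem_freeGrading : (1 : FreeNonassoc F X₀ X₁) ∈ freeGrading F X₀ X₁ 0 := by
  rw [freeGrading, MonoidAlgebra.supported_eq_span_single]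
  exact Submodule.subset_span ⟨1, map_one _, rfl⟩

theorem GammaRel.homogeneous {r : FreeNonassoc F X₀ X₁} (h : GammaRel F r) :
    ∃ i, r ∈ freeGrading F X₀ X₁ i := by
  have M := @(freeGrading_isSuperalgebra (F := F) (X₀ := X₀) (X₁ := X₁)).mul_mem
  have e : (1 : ZMod 2) + 1 = 0 := by decide
  cases h with
  | comm a x ha hx => exact ⟨1, sub_mem (by simpa using M ha hx) (by simpa using M hx ha)⟩
  | assoc i j a b c ha hb hc =>
    exact ⟨0 + i + j, sub_mem (M (M ha hb) hc) (by rw [add_assoc]; exact M ha (M hb hc))⟩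
  | center x y a hx hy ha =>
    exact ⟨1 + 1, sub_mem (by simpa using M (M hx hy) ha) (by simpa using M ha (M hx hy))⟩
  | skew x y hx hy => exact ⟨1 + 1, add_mem (M hx hy) (M hy hx)⟩
  | sq_zero x hx => exact ⟨1 + 1, M hx hx⟩
  | cyclic x y z hx hy hz =>
    exact ⟨1 + 1 + 1, add_mem (add_mem (M (M hx hy) hz) (M (M hy hz) hx)) (M (M hz hx) hy)⟩

theorem exists_add_of_isSuperalgebra {A : Type*} [NonUnitalNonAssocRing A] [Module F A]
    {𝒜 : ZMod 2 → Submodule F A} (h : IsSuperalgebra 𝒜) (x : A) :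
    ∃ a ∈ 𝒜 0, ∃ b ∈ 𝒜 1, a + b = x :=
  Submodule.mem_sup.1 (by rw [h.isCompl.sup_eq_top]; trivial)

/-- An ideal generated by homogeneous elements is graded. -/
theorem idealSpan_le_graded {A : Type*} [NonUnitalNonAssocRing A] [Module F A]
    {𝒜 : ZMod 2 → Submodule F A} (h : IsSuperalgebra 𝒜) {S : Set A}
    (hS : ∀ s ∈ S, ∃ i, s ∈ 𝒜 i) :
    idealSpan F S ≤ (idealSpan F S ⊓ 𝒜 0) ⊔ (idealSpan F S ⊓ 𝒜 1) := by
  set I := idealSpan F S with hI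
  have hi : ∀ i : ZMod 2, I ⊓ 𝒜 i ≤ (I ⊓ 𝒜 0) ⊔ (I ⊓ 𝒜 1) := by
    intro i
    fin_cases i
    · exact le_sup_left
    · exact le_sup_right
  refine idealSpan_le (fun s hs => ?_) (fun a x hx => ?_)
  · obtain ⟨i, his⟩ := hS s hs
    exact hi i ⟨subset_idealSpan S hs, his⟩
  · obtain ⟨y, ⟨hyI, hy⟩, z, ⟨hzI, hz⟩, rfl⟩ := Submodule.mem_sup.1 hx
    obtain ⟨b, hb, c, hc, rfl⟩ := exists_add_of_isSuperalgebra h a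
    simp only [mul_add, add_mul]
    refine ⟨add_mem (add_mem ?_ ?_) (add_mem ?_ ?_), add_mem (add_mem ?_ ?_) (add_mem ?_ ?_)⟩
    · exact hi _ ⟨mul_mem_idealSpan _ hyI, h.mul_mem hb hy⟩
    · exact hi _ ⟨mul_mem_idealSpan _ hyI, h.mul_mem hc hy⟩
    · exact hi _ ⟨mul_mem_idealSpan _ hzI, h.mul_mem hb hz⟩
    · exact hi _ ⟨mul_mem_idealSpan _ hzI, h.mul_mem hc hz⟩
    · exact hi _ ⟨idealSpan_mul_mem _ hyI, h.mul_mem hy hb⟩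
    · exact hi _ ⟨idealSpan_mul_mem _ hzI, h.mul_mem hz hb⟩
    · exact hi _ ⟨idealSpan_mul_mem _ hyI, h.mul_mem hy hc⟩
    · exact hi _ ⟨idealSpan_mul_mem _ hzI, h.mul_mem hz hc⟩

theorem quotient_isSuperalgebra {A : Type*} [NonUnitalNonAssocRing A] [Module F A]
    {𝒜 : ZMod 2 → Submodule F A} (h : IsSuperalgebra 𝒜) {S : Set A}
    (hS : ∀ s ∈ S, ∃ i, s ∈ 𝒜 i) :
    IsSuperalgebra (fun i => (𝒜 i).map (AlgQuot.mkₗ F S)) where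
  isCompl := by
    constructor
    · rw [Submodule.disjoint_def]
      rintro _ ⟨a, ha, rfl⟩ ⟨b, hb, hab⟩
      have hmem := (AlgQuot.mkₗ_eq_iff S).1 hab.symm
      obtain ⟨y, ⟨hyI, hy⟩, z, ⟨hzI, hz⟩, hyz⟩ :=
        Submodule.mem_sup.1 (idealSpan_le_graded h hS hmem)
      have h1 : a - y = b + z := by
        rw [sub_eq_iff_eq_add, add_assoc, add_comm z y, hyz]; abel
      have h0 : a - y = 0 := Submodule.disjoint_def.1 h.isCompl.disjoint _ (sub_mem ha hy)
        (h1 ▸ add_mem hb hz)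
      exact (AlgQuot.mkₗ_eq_zero_iff S).2 (by rw [sub_eq_zero.1 h0]; exact hyI)
    · rw [codisjoint_iff, ← Submodule.map_sup, h.isCompl.sup_eq_top, Submodule.map_top,
        LinearMap.range_eq_top]
      exact AlgQuot.mkₗ_surjective S
  mul_mem := by
    rintro i j _ _ ⟨a, ha, rfl⟩ ⟨b, hb, rfl⟩
    exact ⟨a * b, h.mul_mem ha hb, rfl⟩

theorem FreeGamma.isGammaAlgebra : IsGammaAlgebra (FreeGamma.grading F X₀ X₁) where
  toIsSuperalgebra := quotient_isSuperalgebra freeGrading_isSuperalgebra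
    (fun _ hs => GammaRel.homogeneous hs)
  one_mem := ⟨1, one_mem_freeGrading, rfl⟩
  comm := by
    rintro _ ⟨a, ha, rfl⟩ _ ⟨x, hx, rfl⟩
    exact (AlgQuot.mkₗ_eq_iff _).2 (subset_idealSpan _ (.comm a x ha hx))
  assoc := by
    rintro _ ⟨a, ha, rfl⟩ b c
    obtain ⟨b, rfl⟩ := AlgQuot.mkₗ_surjective _ b
    obtain ⟨c, rfl⟩ := AlgQuot.mkₗ_surjective _ c
    obtain ⟨b₀, hb₀, b₁, hb₁, rfl⟩ := exists_add_of_isSuperalgebra freeGrading_isSuperalgebra b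
    obtain ⟨c₀, hc₀, c₁, hc₁, rfl⟩ := exists_add_of_isSuperalgebra freeGrading_isSuperalgebra c
    have key : ∀ i j : ZMod 2, ∀ b ∈ freeGrading F X₀ X₁ i, ∀ c ∈ freeGrading F X₀ X₁ j,
        AlgQuot.mkₗ F {r | GammaRel F r} a * AlgQuot.mkₗ F _ b * AlgQuot.mkₗ F _ c =
          AlgQuot.mkₗ F _ a * (AlgQuot.mkₗ F _ b * AlgQuot.mkₗ F _ c) :=
      fun i j b hb c hc =>
        (AlgQuot.mkₗ_eq_iff _).2 (subset_idealSpan _ (.assoc i j a b c ha hb hc))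
    simp only [map_add, mul_add, add_mul]
    rw [key _ _ _ hb₀ _ hc₀, key _ _ _ hb₀ _ hc₁, key _ _ _ hb₁ _ hc₀, key _ _ _ hb₁ _ hc₁]
  center := by
    rintro _ ⟨x, hx, rfl⟩ _ ⟨y, hy, rfl⟩ _ ⟨a, ha, rfl⟩
    exact (AlgQuot.mkₗ_eq_iff _).2 (subset_idealSpan _ (.center x y a hx hy ha))
  skew := by
    rintro _ ⟨x, hx, rfl⟩ _ ⟨y, hy, rfl⟩
    exact (AlgQuot.mkₗ_eq_zero_iff _).2 (subset_idealSpan _ (.skew x y hx hy))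
  sq_zero := by
    rintro _ ⟨x, hx, rfl⟩
    exact (AlgQuot.mkₗ_eq_zero_iff _).2 (subset_idealSpan _ (.sq_zero x hx))
  cyclic := by
    rintro _ ⟨x, hx, rfl⟩ _ ⟨y, hy, rfl⟩ _ ⟨z, hz, rfl⟩
    exact (AlgQuot.mkₗ_eq_zero_iff _).2 (subset_idealSpan _ (.cyclic x y z hx hy hz))

/-- The universal property: a map from the generators to a `Γ`-algebra that respects parity extends
uniquely to a homomorphism of unital algebras, and the latter preserves the grading. -/
theorem FreeGamma.existsUnique_hom {G : Type*} [NonAssocRing G] [Module F G] [IsScalarTower F G G]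
    [SMulCommClass F G G] {𝒢 : ZMod 2 → Submodule F G} (hG : IsGammaAlgebra 𝒢)
    (f₀ : X₀ → G) (f₁ : X₁ → G) (h₀ : ∀ x, f₀ x ∈ 𝒢 0) (h₁ : ∀ x, f₁ x ∈ 𝒢 1) :
    (∃! φ : FreeGamma F X₀ X₁ →ₙₐ[F] G, φ 1 = 1 ∧ (∀ x, φ (FreeGamma.ofEven x) = f₀ x) ∧
      ∀ x, φ (FreeGamma.ofOdd x) = f₁ x) ∧
    ∀ φ : FreeGamma F X₀ X₁ →ₙₐ[F] G, φ 1 = 1 → (∀ x, φ (FreeGamma.ofEven x) = f₀ x) →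
      (∀ x, φ (FreeGamma.ofOdd x) = f₁ x) →
      ∀ i, ∀ y ∈ FreeGamma.grading F X₀ X₁ i, φ y ∈ 𝒢 i := by
  let g : Word X₀ X₁ →* G := WithOne.lift (FreeMagma.lift (Sum.elim f₀ f₁))
  let ψ : FreeNonassoc F X₀ X₁ →ₙₐ[F] G := MonoidAlgebra.liftMagma F g.toMulHom
  have hψs : ∀ w c, ψ (MonoidAlgebra.single w c) = c • g w := by
    intro w c
    simp [ψ, MonoidAlgebra.liftMagma]
  have hg : ∀ w, g w ∈ 𝒢 (Multiplicative.toAdd (parity w)) := by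
    intro w
    induction w using WithOne.recOneCoe with
    | one => simpa using hG.one_mem
    | coe w =>
      induction w using FreeMagma.recOnMul with
      | ih1 x =>
        rcases x with x | x
        · exact h₀ x
        · exact h₁ x
      | ih2 x y hx hy =>
        simpa only [map_mul, WithOne.coe_mul, toAdd_mul] using hG.mul_mem hx hy
  have hψg : ∀ i, ∀ y ∈ freeGrading F X₀ X₁ i, ψ y ∈ 𝒢 i := by
    intro i
    have : freeGrading F X₀ X₁ i ≤ (𝒢 i).comap (ψ : FreeNonassoc F X₀ X₁ →ₗ[F] G) := by
      rw [freeGrading, MonoidAlgebra.supported_eq_span_single, Submodule.span_le]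
      rintro _ ⟨w, hw, rfl⟩
      change ψ (MonoidAlgebra.single w 1) ∈ 𝒢 i
      rw [hψs, one_smul]
      simpa only [show parity w = Multiplicative.ofAdd i from hw, toAdd_ofAdd] using hg w
    exact this
  have hψr : ∀ r, GammaRel F r → ψ r = 0 := by
    intro r hr
    cases hr with
    | comm a x ha hx =>
      simpa [sub_eq_zero] using hG.comm _ (hψg _ _ ha) _ (hψg _ _ hx)
    | assoc i j a b c ha hb hc =>
      simpa [sub_eq_zero] using hG.assoc _ (hψg _ _ ha) (ψ b) (ψ c)
    | center x y a hx hy ha =>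
      simpa [sub_eq_zero] using hG.center _ (hψg _ _ hx) _ (hψg _ _ hy) _ (hψg _ _ ha)
    | skew x y hx hy => simpa using hG.skew _ (hψg _ _ hx) _ (hψg _ _ hy)
    | sq_zero x hx => simpa using hG.sq_zero _ (hψg _ _ hx)
    | cyclic x y z hx hy hz =>
      simpa using hG.cyclic _ (hψg _ _ hx) _ (hψg _ _ hy) _ (hψg _ _ hz)
  have uniq : ∀ φ : FreeGamma F X₀ X₁ →ₙₐ[F] G, φ 1 = 1 → (∀ x, φ (FreeGamma.ofEven x) = f₀ x) →
      (∀ x, φ (FreeGamma.ofOdd x) = f₁ x) → ∀ y, φ (AlgQuot.mkₗ F _ y) = ψ y := by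
    intro φ e e₀ e₁ y
    induction y using MonoidAlgebra.induction_linear with
    | zero => simp
    | add f g hf hg => simp only [map_add, hf, hg]
    | single w c =>
      have hw : φ (AlgQuot.mkₗ F _ (MonoidAlgebra.single w 1)) = g w := by
        induction w using WithOne.recOneCoe with
        | one => rw [map_one]; exact e
        | coe w =>
          induction w using FreeMagma.recOnMul with
          | ih1 x =>
            rcases x with x | x
            · exact e₀ x
            · exact e₁ x
          | ih2 x y hx hy =>
            have : (MonoidAlgebra.single (((x * y : FreeMagma (X₀ ⊕ X₁))) : Word X₀ X₁) (1 : F)) =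
              MonoidAlgebra.single (x : Word X₀ X₁) 1 * MonoidAlgebra.single (y : Word X₀ X₁) 1 := by
              rw [MonoidAlgebra.single_mul_single, one_mul, WithOne.coe_mul]
            rw [this, AlgQuot.mkₗ_mul, map_mul, hx, hy, ← map_mul, WithOne.coe_mul]
      have hc : MonoidAlgebra.single w c = c • MonoidAlgebra.single w (1 : F) := by simp
      rw [hψs, hc, map_smul, map_smul, hw]
  refine ⟨⟨AlgQuot.lift ψ hψr, ⟨?_, fun x => ?_, fun x => ?_⟩, ?_⟩, ?_⟩
  · change ψ (MonoidAlgebra.single 1 1) = 1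
    rw [hψs, one_smul, map_one]
  · change ψ (MonoidAlgebra.single _ 1) = _
    rw [hψs, one_smul]
    rfl
  · change ψ (MonoidAlgebra.single _ 1) = _
    rw [hψs, one_smul]
    rfl
  · rintro φ ⟨e, e₀, e₁⟩
    ext y
    obtain ⟨y, rfl⟩ := AlgQuot.mkₗ_surjective _ y
    exact uniq φ e e₀ e₁ y
  · rintro φ e e₀ e₁ i _ ⟨y, hy, rfl⟩
    rw [uniq φ e e₀ e₁ y]
    exact hψg i y hy

end FreeGamma

section GammaEnvelope

variable {F : Type*} [Field F] {Γ : Type*} [NonAssocRing Γ] [Module F Γ] [IsScalarTower F Γ Γ]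
  [SMulCommClass F Γ Γ] {𝒢 : ZMod 2 → Submodule F Γ}

/-- The `Γ`-envelope `Γ(B(4,2)) = Γ₀ ⊗ M₂(F) + Γ₁ ⊗ Cay`. -/
abbrev gammaEnvelope (h : IsGammaAlgebra 𝒢) : NonUnitalSubalgebra F (Γ ⊗[F] B42 F) :=
  envelope h.toIsSuperalgebra B42.isSuperalgebra

/-- The canonical map `M₂(F) → Γ(B(4,2))`, `a ↦ 1 ⊗ a`. -/
def matrixToEnvelope (h : IsGammaAlgebra 𝒢) (a : M2 F) : gammaEnvelope h :=
  ⟨(1 : Γ) ⊗ₜ[F] (⟨a, 0⟩ : B42 F),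
    tmul_mem_envelope _ _ h.one_mem (B42.mem_grading_zero.2 rfl)⟩

end GammaEnvelope

/-! ### Alternative bimodules and their tensor algebras -/

/-- An alternative bimodule structure over the algebra `A` on the space `V`: two bilinear actions
for which the split null extension `A ⊕ V` satisfies the alternative laws
`(x, x, y) = 0 = (y, x, x)` in all cases where exactly one argument is from `V`. -/
structure AltBimodule (F A V : Type*) [Field F] [NonUnitalNonAssocRing A] [Module F A]
    [AddCommGroup V] [Module F V] where
  left : A →ₗ[F] V →ₗ[F] V
  right : A →ₗ[F] V →ₗ[F] V
  left_left : ∀ a v, left (a * a) v = left a (left a v)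
  right_right : ∀ a v, right a (right a v) = right (a * a) v
  left_alt : ∀ a b v,
    (right b (left a v) - left a (right b v)) + (right b (right a v) - right (a * b) v) = 0
  right_alt : ∀ a b v,
    (left (b * a) v - left b (left a v)) + (right a (left b v) - left b (right a v)) = 0

namespace AltBimodule

variable {F A V W : Type*} [Field F] [NonUnitalNonAssocRing A] [Module F A]
  [AddCommGroup V] [Module F V] [AddCommGroup W] [Module F W]

/-- The direct sum of two alternative bimodules. -/
def prod (M : AltBimodule F A V) (N : AltBimodule F A W) : AltBimodule F A (V × W) where
  left := LinearMap.mk₂ F (fun a v => (M.left a v.1, N.left a v.2))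
    (by intros; simp) (by intros; simp) (by intros; simp) (by intros; simp)
  right := LinearMap.mk₂ F (fun a v => (M.right a v.1, N.right a v.2))
    (by intros; simp) (by intros; simp) (by intros; simp) (by intros; simp)
  left_left a v := Prod.ext (M.left_left a v.1) (N.left_left a v.2)
  right_right a v := Prod.ext (M.right_right a v.1) (N.right_right a v.2)
  left_alt a b v := Prod.ext (M.left_alt a b v.1) (N.left_alt a b v.2)
  right_alt a b v := Prod.ext (M.right_alt a b v.1) (N.right_alt a b v.2)

/-- The direct sum of copies of an alternative bimodule, indexed by `X`. -/
def copies (X : Type*) (M : AltBimodule F A V) : AltBimodule F A (X →₀ V) where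
  left := LinearMap.mk₂ F (fun a v => v.mapRange (M.left a) (map_zero _))
    (by intros; ext; simp) (by intros; ext; simp) (by intros; ext; simp) (by intros; ext; simp)
  right := LinearMap.mk₂ F (fun a v => v.mapRange (M.right a) (map_zero _))
    (by intros; ext; simp) (by intros; ext; simp) (by intros; ext; simp) (by intros; ext; simp)
  left_left a v := Finsupp.ext fun x => M.left_left a (v x)
  right_right a v := Finsupp.ext fun x => M.right_right a (v x)
  left_alt a b v := Finsupp.ext fun x => M.left_alt a b (v x)
  right_alt a b v := Finsupp.ext fun x => M.right_alt a b (v x)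

variable (F) in
/-- The regular bimodule `Reg` of `M₂(F)`: the space `M₂(F)`, with the left and right
multiplications. -/
def reg : AltBimodule F (M2 F) (M2 F) where
  left := LinearMap.mk₂ F (fun a v => a * v)
    (by intros; simp [add_mul]) (by intros; simp) (by intros; simp [mul_add]) (by intros; simp)
  right := LinearMap.mk₂ F (fun a v => v * a)
    (by intros; simp [mul_add]) (by intros; simp) (by intros; simp [add_mul]) (by intros; simp)
  left_left a v := by simp [mul_assoc]
  right_right a v := by simp [mul_assoc]
  left_alt a b v := by simp [mul_assoc]
  right_alt a b v := by simp [mul_assoc]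

variable (F) in
/-- The bimodule `Cay = F m₁ + F m₂` over `M₂(F)`, with `eᵢⱼ · mₖ = δᵢₖ mⱼ` and `m · a = ā · m`. -/
def cay : AltBimodule F (M2 F) (Fin 2 → F) where
  left := LinearMap.mk₂ F (fun a v => Matrix.vecMul v a)
    (by intros; simp [Matrix.vecMul_add]) (by intros; simp [Matrix.vecMul_smul])
    (by intros; simp [Matrix.add_vecMul]) (by intros; simp [Matrix.smul_vecMul])
  right := LinearMap.mk₂ F (fun a v => Matrix.vecMul v a.adjugate)
    (by intros; simp [Matrix.vecMul_add, B42.adjugate_add])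
    (by intros; simp [Matrix.vecMul_smul, B42.adjugate_smul])
    (by intros; simp [Matrix.add_vecMul]) (by intros; simp [Matrix.smul_vecMul])
  left_left a v := by simp
  right_right a v := by simp [Matrix.adjugate_mul_distrib]
  left_alt a b v := by
    have h : a * b.adjugate - b.adjugate * a + (a.adjugate * b.adjugate - (a * b).adjugate) = 0 := by
      rw [Matrix.eta_fin_two a, Matrix.eta_fin_two b]
      ext i j
      fin_cases i <;> fin_cases j <;>
        simp [Matrix.adjugate_fin_two_of] <;> ring
    simp only [LinearMap.mk₂_apply, Matrix.vecMul_vecMul, ← Matrix.vecMul_sub, ← Matrix.vecMul_add,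
      h, Matrix.vecMul_zero]
  right_alt a b v := by
    have h : b * a - a * b + (b * a.adjugate - a.adjugate * b) = 0 := by
      rw [Matrix.eta_fin_two a, Matrix.eta_fin_two b]
      ext i j
      fin_cases i <;> fin_cases j <;>
        simp [Matrix.adjugate_fin_two_of] <;> ring
    simp only [LinearMap.mk₂_apply, Matrix.vecMul_vecMul, ← Matrix.vecMul_sub, ← Matrix.vecMul_add,
      h, Matrix.vecMul_zero]

end AltBimodule

section TensorAlgebra

/-- The relations that define the free alternative algebra on the vector space `W` inside the free
nonassociative algebra on the set `W`: linearity of the inclusion of `W` and the two alternative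
laws. -/
inductive AltRel (F W : Type*) [Field F] [AddCommGroup W] [Module F W] :
    FreeNonUnitalNonAssocAlgebra F W → Prop
  | add (v w : W) : AltRel F W (FreeNonUnitalNonAssocAlgebra.of F (v + w) -
      (FreeNonUnitalNonAssocAlgebra.of F v + FreeNonUnitalNonAssocAlgebra.of F w))
  | smul (c : F) (w : W) : AltRel F W (FreeNonUnitalNonAssocAlgebra.of F (c • w) -
      c • FreeNonUnitalNonAssocAlgebra.of F w)
  | left_alt (x y : FreeNonUnitalNonAssocAlgebra F W) : AltRel F W ((x * x) * y - x * (x * y))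
  | right_alt (x y : FreeNonUnitalNonAssocAlgebra F W) : AltRel F W ((y * x) * x - y * (x * x))

/-- The free alternative algebra on the vector space `W`. -/
abbrev FreeAlternative (F W : Type*) [Field F] [AddCommGroup W] [Module F W] : Type _ :=
  AlgQuot F {r : FreeNonUnitalNonAssocAlgebra F W | AltRel F W r}

/-- The inclusion of `W` in the free alternative algebra. -/
def FreeAlternative.of (F : Type*) {W : Type*} [Field F] [AddCommGroup W] [Module F W] (w : W) :
    FreeAlternative F W :=
  AlgQuot.mk F _ (FreeNonUnitalNonAssocAlgebra.of F w)

variable {F A V : Type*} [Field F] [NonUnitalNonAssocRing A] [Module F A]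
  [AddCommGroup V] [Module F V]

/-- The relations `a * b = ab`, `a * v = a · v`, `v * a = v · a` in the free alternative algebra on
`A ⊕ V`. -/
inductive TensorRel (M : AltBimodule F A V) : FreeAlternative F (A × V) → Prop
  | mul (a b : A) : TensorRel M (FreeAlternative.of F ((a, 0) : A × V) *
      FreeAlternative.of F ((b, 0) : A × V) - FreeAlternative.of F ((a * b, 0) : A × V))
  | left (a : A) (v : V) : TensorRel M (FreeAlternative.of F ((a, 0) : A × V) *
      FreeAlternative.of F ((0, v) : A × V) - FreeAlternative.of F ((0, M.left a v) : A × V))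
  | right (a : A) (v : V) : TensorRel M (FreeAlternative.of F ((0, v) : A × V) *
      FreeAlternative.of F ((a, 0) : A × V) - FreeAlternative.of F ((0, M.right a v) : A × V))

/-- The tensor algebra `A[V]` of an alternative `A`-bimodule `V` in the variety of alternative
algebras. -/
abbrev BimodTensorAlgebra (M : AltBimodule F A V) : Type _ :=
  AlgQuot F {r : FreeAlternative F (A × V) | TensorRel M r}

/-- The canonical map `A → A[V]`. -/
def toTensor (M : AltBimodule F A V) (a : A) : BimodTensorAlgebra M :=
  AlgQuot.mk F _ (FreeAlternative.of F ((a, 0) : A × V))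

end TensorAlgebra

end GammaAlg

end

open scoped TensorProduct

noncomputable section

namespace GammaAlg

/-! ### Alternative rings -/

/-! Both algebras are universal, and the isomorphism comes from playing their universal properties
against each other.

From the envelope to `M₂[V]`. Let `A` be an alternative algebra, unital or not, with elements `eᵢⱼ`
that multiply as matrix units (`e 0 0` is `e₁₁`, and so on). Put `Γ₀ = e₁₁Ae₁₁` and `Γ₁ = {u ∈
e₁₁Ae₂₂ : u e₂₁ = 0}`. In an envelope these are the elements `γ ⊗ e₁₁` and `γ ⊗ m₁`; the condition
`u e₂₁ = 0` excludes `γ ⊗ e₁₂`, because `(γ ⊗ e₁₂)(1 ⊗ e₂₁) = γ ⊗ e₁₁`. With the product of `A` on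
`Γ₀`, the action `a · u = u · a = au` and the odd product `u · v = e₁₂(uv)`, the space `Γ₀ ⊕ Γ₁` is
a `Γ`-algebra (`CoordAlgebra.isGammaAlgebra`), and `γ ⊗ eᵢⱼ ↦ (eᵢ₁γ)e₁ⱼ`, `u ⊗ mₖ ↦ e₁ₖu` is
multiplicative on its envelope (`CoordAlgebra.coordMap_mul`). For `A = M₂[V]` the vector `e₁₁` of
each copy of `Reg` lies in `Γ₀` and the vector `m₁` of each copy of `Cay` lies in `Γ₁`, so freeness
of `Γ[X₀, X₁]` yields a homomorphism `φ` to `M₂[V]`.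

From `M₂[V]` to the envelope. The envelope of every `Γ`-algebra is alternative
(`IsGammaAlgebra.isAlternative_gammaEnvelope`). An even generator `x` spans a copy `x ⊗ M₂` of `Reg`
in it and an odd one a copy `x ⊗ Cay` of `Cay`, so the universal property of the tensor algebra
yields `ψ`.

Conclusion. `φ ∘ ψ` fixes `M₂ ⊕ V`, hence is the identity. `ψ` is onto, because the envelope is
generated by `1 ⊗ M₂`, the `x ⊗ M₂` and the `x ⊗ Cay` (`envelope_le_of_generators`). Thus `φ` is
bijective. That every `A` as above is itself an envelope is never needed.

The identities in `A` follow from skew-symmetry of the associator, the Moufang identities and the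
Peirce rules. Characteristic 2 causes no trouble, because quadratic identities are checked on the
diagonal and in polarized form. -/

/-- The alternative laws `(x, x, y) = 0 = (y, x, x)`. -/
class IsAlternative (A : Type*) [NonUnitalNonAssocRing A] : Prop where
  left_alt (x y : A) : (x * x) * y = x * (x * y)
  right_alt (x y : A) : (y * x) * x = y * (x * x)

namespace IsAlternative

variable {A : Type*} [NonUnitalNonAssocRing A] [IsAlternative A]

theorem associator_swap_left (x y z : A) : associator x y z = -associator y x z := by
  have h := left_alt (x + y) z
  simp only [add_mul, mul_add, left_alt] at h
  rw [eq_neg_iff_add_eq_zero, associator, associator, ← sub_eq_zero.2 h]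
  abel

theorem associator_swap_right (x y z : A) : associator x y z = -associator x z y := by
  have h := right_alt (y + z) x
  simp only [add_mul, mul_add, right_alt] at h
  rw [eq_neg_iff_add_eq_zero, associator, associator, ← sub_eq_zero.2 h]
  abel

theorem associator_rotate (x y z : A) : associator x y z = associator y z x := by
  rw [associator_swap_left, associator_swap_right, neg_neg]

theorem associator_reverse (x y z : A) : associator x y z = -associator z y x := by
  rw [associator_rotate, associator_swap_left]

theorem associator_self_left (x y : A) : associator x x y = 0 := by
  rw [associator, left_alt, sub_self]

theorem flexible (x y : A) : (x * y) * x = x * (y * x) := by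
  have h : associator x y x = 0 := by
    rw [associator_swap_right, associator_self_left, neg_zero]
  rwa [associator, sub_eq_zero] at h

theorem left_alt_add (x y z : A) : (x * y + y * x) * z = x * (y * z) + y * (x * z) := by
  have h := associator_swap_left x y z
  rw [eq_neg_iff_add_eq_zero, associator, associator] at h
  rw [add_mul, ← sub_eq_zero, ← h]
  abel

theorem right_alt_add (x y z : A) : z * (x * y + y * x) = (z * x) * y + (z * y) * x := by
  have h := associator_swap_right z x y
  rw [eq_neg_iff_add_eq_zero, associator, associator] at h
  rw [mul_add, eq_comm, ← sub_eq_zero, ← h]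
  abel

/-- The left Moufang identity. -/
theorem left_moufang (x y z : A) : ((x * y) * x) * z = x * (y * (x * z)) := by
  -- `h1 + h2` gives the claim up to `(x²y)z + (x²z)y - x((xy)z) - x((xz)y)`. By `h3` and `h4` this
  -- equals `x²w - x(xw)` with `w = yz + zy`, which is zero.
  have h1 := associator_swap_left (x * y) x z
  have h2 := associator_swap_right x y (x * z)
  have h3 := right_alt_add y z (x * x)
  have h4 := congrArg (x * ·) (right_alt_add y z x)
  simp only [associator, mul_add, ← left_alt] at h1 h2 h3 h4
  linear_combination (norm := abel) h1 + h2 + h3 - h4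

/-- The right Moufang identity. -/
theorem right_moufang (x y z : A) : z * ((x * y) * x) = ((z * x) * y) * x := by
  have h1 := associator_swap_right z x (y * x)
  have h2 := associator_swap_left (z * x) y x
  have h3 := left_alt_add y z (x * x)
  have h4 := congrArg (· * x) (left_alt_add y z x)
  simp only [associator, add_mul, ← right_alt, flexible] at h1 h2 h3 h4 ⊢
  linear_combination (norm := abel) - h1 - h2 + h3 - h4

end IsAlternative

/-! ### Matrix units and Peirce components -/

/-- The elements `e i j` multiply as the matrix units of `M₂`. -/
def IsMatrixUnits {A : Type*} [NonUnitalNonAssocRing A] (e : Fin 2 → Fin 2 → A) : Prop :=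
  ∀ i j k l, e i j * e k l = if j = k then e i l else 0

/-- `x` lies in the Peirce component `e i i * A * e j j`. -/
structure Peirce {A : Type*} [NonUnitalNonAssocRing A] (e : Fin 2 → Fin 2 → A) (i j : Fin 2)
    (x : A) : Prop where
  left : ∀ k, e k k * x = if i = k then x else 0
  right : ∀ k, x * e k k = if j = k then x else 0

namespace Peirce

open IsAlternative

variable {A : Type*} [NonUnitalNonAssocRing A] {e : Fin 2 → Fin 2 → A}

theorem add {i j : Fin 2} {x y : A} (hx : Peirce e i j x) (hy : Peirce e i j y) :
    Peirce e i j (x + y) where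
  left k := by
    rw [mul_add, hx.left, hy.left]
    split_ifs <;> simp
  right k := by
    rw [add_mul, hx.right, hy.right]
    split_ifs <;> simp

theorem zero (i j : Fin 2) : Peirce e i j 0 where
  left k := by simp
  right k := by simp

theorem smul {F : Type*} [Field F] [Module F A] [IsScalarTower F A A] [SMulCommClass F A A]
    {i j : Fin 2} {x : A} (c : F) (hx : Peirce e i j x) : Peirce e i j (c • x) where
  left k := by
    rw [mul_smul_comm, hx.left]
    split_ifs <;> simp
  right k := by
    rw [smul_mul_assoc, hx.right]
    split_ifs <;> simp

theorem unit (he : IsMatrixUnits e) (i j : Fin 2) : Peirce e i j (e i j) where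
  left k := by
    rw [he]
    by_cases h : i = k
    · subst h; simp
    · rw [if_neg h, if_neg (Ne.symm h)]
  right k := by
    rw [he]
    by_cases h : j = k
    · subst h; simp
    · rw [if_neg h, if_neg h]

variable [IsAlternative A] {i j k l : Fin 2} {x y z : A}

/-- Linearized left alternativity. For `a = eₖₖ` the right side is known from the Peirce components
of `x` and `y`, so this and `mul_idem` locate every product. -/
theorem idem_mul (a x y : A) : a * (x * y) = (a * x) * y + (x * a) * y - x * (a * y) := by
  rw [eq_sub_iff_add_eq, ← left_alt_add, add_mul]

theorem mul_idem (a x y : A) : (x * y) * a = x * (y * a) + x * (a * y) - (x * a) * y := by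
  rw [eq_sub_iff_add_eq, ← right_alt_add, mul_add, add_comm]

theorem mul (hx : Peirce e i j x) (hy : Peirce e j k y) : Peirce e i k (x * y) where
  left m := by
    rw [idem_mul, hx.left, hx.right, hy.left]
    split_ifs <;> simp
  right m := by
    rw [mul_idem, hx.right, hy.left, hy.right]
    split_ifs <;> simp

/-- For `i ≠ j` this product would be zero in an associative ring. In an alternative one it survives
and falls into the opposite component, which is where the products of odd elements live. -/
theorem mul_off (hx : Peirce e i j x) (hy : Peirce e i j y) :
    Peirce e j i (x * y) where
  left m := by
    rw [idem_mul, hx.left, hx.right, hy.left]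
    split_ifs with h1 h2 <;> simp
  right m := by
    rw [mul_idem, hx.right, hy.left, hy.right]
    split_ifs with h1 h2 <;> simp

/-- Of two factors with mismatched indices, not from the same off-diagonal component, one is
diagonal. Writing that factor as `(e z) e` with its idempotent `e`, a Moufang identity brings `e`
next to the other factor, which it annihilates. -/
theorem mul_eq_zero (hx : Peirce e i j x) (hy : Peirce e k l y) (hjk : j ≠ k)
    (h : ¬(i = k ∧ j = l)) : x * y = 0 := by
  by_cases hij : i = j
  · subst hij
    have h1 : (e i i * x) * e i i = x := by rw [hx.left, if_pos rfl, hx.right, if_pos rfl]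
    rw [← h1, left_moufang, hy.left, if_neg hjk.symm, mul_zero, mul_zero]
  · have hkl : k = l := by
      omega
    subst hkl
    have h1 : (e k k * y) * e k k = y := by rw [hy.left, if_pos rfl, hy.right, if_pos rfl]
    rw [← h1, right_moufang, hx.right, if_neg hjk, zero_mul, zero_mul]

/-- Flexibility `(x eᵢᵢ)x = x(eᵢᵢ x)` reads `0 = x²`. No division by 2 occurs. -/
theorem mul_self_eq_zero (hij : i ≠ j) (hx : Peirce e i j x) : x * x = 0 := by
  have h := flexible x (e i i)
  rw [hx.left, hx.right, if_neg hij.symm, if_pos rfl, zero_mul] at h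
  exact h.symm

theorem mul_comm_neg (hij : i ≠ j) (hx : Peirce e i j x) (hy : Peirce e i j y) :
    x * y = -(y * x) := by
  have h := (hx.add hy).mul_self_eq_zero hij
  rw [add_mul, mul_add, mul_add, hx.mul_self_eq_zero hij, hy.mul_self_eq_zero hij, zero_add,
    add_zero] at h
  exact eq_neg_of_add_eq_zero_left h

/-- The associator is skew. After a transposition that puts `y` before `x`, or `z` before `y`, the
inner indices no longer match and both of its terms vanish. The excluded patterns `(ij)(ji)(ij)`
must be treated individually below. -/
theorem assoc (hx : Peirce e i j x) (hy : Peirce e j k y) (hz : Peirce e k l z)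
    (h : i ≠ k ∨ j ≠ l) : (x * y) * z = x * (y * z) := by
  rw [← sub_eq_zero]
  change associator x y z = 0
  rcases h with h | h
  · rw [associator_swap_left, neg_eq_zero, associator,
      hy.mul_eq_zero hx h.symm (fun h' => h (h'.1 ▸ h'.2.symm)), zero_mul, zero_sub, neg_eq_zero]
    by_cases hjk : j = k
    · subst hjk
      exact hy.mul_eq_zero (hx.mul hz) h.symm (fun h' => h h'.1.symm)
    · rw [hx.mul_eq_zero hz hjk (fun h' => h h'.1), mul_zero]
  · rw [associator_swap_right, neg_eq_zero, associator,
      hz.mul_eq_zero hy h.symm (fun h' => h (h'.1 ▸ h'.2.symm)), mul_zero, sub_zero]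
    by_cases hjk : j = k
    · subst hjk
      exact (hx.mul hz).mul_eq_zero hy h.symm (fun h' => h h'.2.symm)
    · rw [hx.mul_eq_zero hz hjk (fun h' => h h'.2), zero_mul]

end Peirce

/-! ### Products of Peirce components in an alternative ring with matrix units -/

/-- The elements of `e₁₁ A e₂₂` that correspond to the vectors `γ ⊗ m₁`. -/
structure IsCayley {A : Type*} [NonUnitalNonAssocRing A] (e : Fin 2 → Fin 2 → A) (u : A) :
    Prop where
  peirce : Peirce e 0 1 u
  mul_unit : u * e 1 0 = 0

namespace IsMatrixUnits

open IsAlternative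

variable {A : Type*} [NonUnitalNonAssocRing A] [IsAlternative A] {e : Fin 2 → Fin 2 → A}

section Peirce

variable {a y z : A}

/-- In `(a, y, z) = (y, z, a)` the terms `a(yz)` and `y(za)` vanish by the Peirce rules. -/
theorem diag_mul_off_mul (ha : Peirce e 0 0 a) (hy : Peirce e 0 1 y) (hz : Peirce e 0 1 z) :
    (a * y) * z = (y * z) * a := by
  have h := associator_rotate a y z
  rwa [associator, associator, ha.mul_eq_zero (hy.mul_off hz) (by decide) (by decide),
    hz.mul_eq_zero ha (by decide) (by decide), mul_zero, sub_zero, sub_zero] at h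

theorem diag_mul_off_mul_swap (ha : Peirce e 0 0 a) (hy : Peirce e 0 1 y) (hz : Peirce e 0 1 z) :
    (a * y) * z = -((a * z) * y) := by
  have h := associator_swap_right a y z
  rwa [associator, associator, ha.mul_eq_zero (hy.mul_off hz) (by decide) (by decide),
    ha.mul_eq_zero (hz.mul_off hy) (by decide) (by decide), sub_zero, sub_zero] at h

theorem off_mul_diag_mul (ha : Peirce e 0 0 a) (hy : Peirce e 1 0 y) (hz : Peirce e 1 0 z) :
    (y * a) * z = a * (y * z) := by
  have h := associator_rotate y a z
  rw [associator, associator, ha.mul_eq_zero hz (by decide) (by decide), mul_zero, zero_mul,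
    sub_zero, zero_sub, ← mul_neg, ← hy.mul_comm_neg (by decide) hz] at h
  exact h

/-- The associator is cyclically invariant, and its two terms lie in the different components
`e₂₂Ae₂₂` and `e₁₁Ae₁₁`. Hence each term is invariant by itself. -/
theorem off_mul_off_mul_off (x : A) (hx : Peirce e 0 1 x) (hy : Peirce e 0 1 y)
    (hz : Peirce e 0 1 z) : x * (y * z) = y * (z * x) ∧ (x * y) * z = (y * z) * x := by
  have h := associator_rotate x y z
  rw [associator, associator] at h
  have h0 := congrArg (e 0 0 * ·) h
  have h1 := congrArg (e 1 1 * ·) h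
  simp only [mul_sub, ((hx.mul_off hy).mul hz).left, ((hy.mul_off hz).mul hx).left,
    (hx.mul (hy.mul_off hz)).left, (hy.mul (hz.mul_off hx)).left] at h0 h1
  simpa using And.intro h0 h1

end Peirce

variable (he : IsMatrixUnits e) {a b u v w : A}
include he

theorem unit_mul_diag_mul (ha : Peirce e 0 0 a) (hu : Peirce e 0 1 u) :
    e 0 1 * (a * u) = (e 0 1 * u) * a := by
  have h := diag_mul_off_mul ha hu (.unit he 0 1)
  rw [(ha.mul hu).mul_comm_neg (by decide) (.unit he 0 1),
    hu.mul_comm_neg (by decide) (.unit he 0 1), neg_mul, neg_inj] at h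
  exact h

/-- Reversing `(u, e₂₁, e₁₂)` gives `e₁₂(e₂₁u) = 0`. Since `e₂₁u` lies in `e₂₂Ae₂₂`, multiplying by
`e₂₁` recovers `e₂₁u` itself. -/
theorem unit_mul_cayley (hu : IsCayley e u) : e 1 0 * u = 0 := by
  have h := associator_reverse u (e 1 0) (e 0 1)
  rw [associator, associator, hu.mul_unit, he, he, if_pos rfl, if_pos rfl, hu.peirce.left,
    hu.peirce.right, if_pos rfl, if_pos rfl, zero_mul, zero_sub, neg_inj, eq_comm,
    sub_eq_self] at h
  have h2 := (Peirce.unit he 1 0).assoc (.unit he 0 1) ((Peirce.unit he 1 0).mul hu.peirce)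
    (by decide)
  rwa [h, he, if_pos rfl, ((Peirce.unit he 1 0).mul hu.peirce).left, if_pos rfl, mul_zero] at h2

theorem unit_mul_unit_mul_cayley (hu : IsCayley e u) : e 1 0 * (e 0 1 * u) = u := by
  have h := associator_swap_left (e 1 0) (e 0 1) u
  rw [associator, associator, he.unit_mul_cayley hu, he, he, if_pos rfl, if_pos rfl,
    hu.peirce.left, hu.peirce.left, if_pos rfl, if_neg (by decide), mul_zero, sub_zero, zero_sub,
    neg_inj] at h
  exact h

theorem cayley_diag_mul (ha : Peirce e 0 0 a) (hu : IsCayley e u) : IsCayley e (a * u) where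
  peirce := ha.mul hu.peirce
  mul_unit := by
    rw [ha.assoc hu.peirce (.unit he 1 0) (by decide), hu.mul_unit, mul_zero]

/-- The factors `a` and `b` come out in the opposite order, so even elements act on odd ones through
commuting operators. Left multiplication by `e₁₂` is injective on `Γ₁`, with inverse `e₂₁`, and it
turns the left action of `Γ₀` into a right one, where the order is reversed. -/
theorem diag_mul_diag_mul_cayley (ha : Peirce e 0 0 a) (hb : Peirce e 0 0 b)
    (hu : IsCayley e u) : b * (a * u) = (a * b) * u := by
  have h : e 0 1 * (b * (a * u)) = e 0 1 * ((a * b) * u) := by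
    rw [he.unit_mul_diag_mul hb (ha.mul hu.peirce), he.unit_mul_diag_mul ha hu.peirce,
      he.unit_mul_diag_mul (ha.mul hb) hu.peirce,
      ((Peirce.unit he 0 1).mul_off hu.peirce).assoc ha hb (by decide)]
  rw [← he.unit_mul_unit_mul_cayley (he.cayley_diag_mul hb (he.cayley_diag_mul ha hu)), h,
    he.unit_mul_unit_mul_cayley (he.cayley_diag_mul (ha.mul hb) hu)]

theorem unit_mul_mul (hu : Peirce e 0 1 u) (hv : Peirce e 0 1 v) :
    e 0 1 * (u * v) = u * (v * e 0 1) :=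
  (off_mul_off_mul_off _ (.unit he 0 1) hu hv).1

theorem mul_unit_mul (hu : Peirce e 0 1 u) (hv : Peirce e 0 1 v) :
    u * (e 0 1 * v) = -(e 0 1 * (u * v)) := by
  rw [he.unit_mul_mul hu hv, hv.mul_comm_neg (by decide) (.unit he 0 1), mul_neg, neg_neg]

theorem unit_mul_mul_right (hu : Peirce e 0 1 u) (hv : Peirce e 0 1 v) :
    (e 0 1 * u) * v = (u * v) * e 0 1 :=
  (off_mul_off_mul_off _ (.unit he 0 1) hu hv).2

theorem peirce_unit_mul_mul (hu : Peirce e 0 1 u) (hv : Peirce e 0 1 v) :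
    Peirce e 0 0 (e 0 1 * (u * v)) :=
  (Peirce.unit he 0 1).mul (hu.mul_off hv)

/-- This is `m₁² = e₂₁`: the product `uv` in `A` is `e₂₁γ`, where `γ = e₁₂(uv)` is the product in
the algebra of coordinates. -/
theorem unit_mul_unit_mul_mul (hu : IsCayley e u) (hv : IsCayley e v) :
    e 1 0 * (e 0 1 * (u * v)) = u * v := by
  have h := associator_swap_left v (e 1 0) (e 0 1 * u)
  rw [associator, associator, hv.mul_unit, he.unit_mul_cayley hv, zero_mul, zero_sub, zero_sub,
    neg_neg, he.unit_mul_unit_mul_cayley hu, he.mul_unit_mul hv.peirce hu.peirce,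
    hv.peirce.mul_comm_neg (by decide) hu.peirce] at h
  simp only [mul_neg, neg_neg] at h
  exact h.symm

theorem cayley_mul_unit_mul_diag (ha : Peirce e 0 0 a) (hu : IsCayley e u) :
    u * (e 1 0 * a) = 0 := by
  rw [← hu.peirce.assoc (.unit he 1 0) ha (by decide), hu.mul_unit, zero_mul]

theorem cayley_mul_diag (ha : Peirce e 0 0 a) (hu : IsCayley e u) :
    u * ((e 1 0 * a) * e 0 1) = a * u := by
  have h1 := associator_rotate u (e 1 0 * a) (e 0 1)
  have h2 := associator_rotate (e 1 0 * a) (e 0 1) u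
  have hp := (Peirce.unit he 1 0).mul ha
  have h0 := he.cayley_mul_unit_mul_diag ha hu
  rw [h2] at h1
  rw [associator, associator, h0, zero_mul, zero_sub, mul_zero, sub_zero,
    (((Peirce.unit he 0 1).mul_off hu.peirce)).mul_comm_neg (by decide) hp,
    off_mul_diag_mul ha (.unit he 1 0) ((Peirce.unit he 0 1).mul_off hu.peirce), neg_inj,
    he.unit_mul_unit_mul_cayley hu] at h1
  exact h1

theorem unit_mul_diag_mul_unit_mul (ha : Peirce e 0 0 a) (hu : IsCayley e u) :
    (e 1 0 * a) * (e 0 1 * u) = a * u := by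
  rw [off_mul_diag_mul ha (.unit he 1 0) ((Peirce.unit he 0 1).mul_off hu.peirce),
    he.unit_mul_unit_mul_cayley hu]

/-- `(γ u) · v = γ (u · v)` for the product `u · v = e₁₂ (u v)`. -/
theorem unit_mul_diag_mul_mul (ha : Peirce e 0 0 a) (hu : Peirce e 0 1 u) (hv : Peirce e 0 1 v) :
    e 0 1 * ((a * u) * v) = a * (e 0 1 * (u * v)) := by
  rw [he.unit_mul_mul (ha.mul hu) hv, he.unit_mul_mul hu hv,
    ha.assoc hu (hv.mul_off (.unit he 0 1)) (by decide)]

/-- This is `Γ₁² ⊆ Z(Γ₀)`. A factor `a` on `u` can leave `(au)v` to the left, by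
`unit_mul_diag_mul_mul`, or to the right, by `diag_mul_off_mul`. -/
theorem unit_mul_mul_diag (ha : Peirce e 0 0 a) (hu : Peirce e 0 1 u) (hv : Peirce e 0 1 v) :
    (e 0 1 * (u * v)) * a = a * (e 0 1 * (u * v)) := by
  rw [← he.unit_mul_diag_mul_mul ha hu hv, diag_mul_off_mul ha hu hv,
    (Peirce.unit he 0 1).assoc (hu.mul_off hv) ha (by decide)]

/-- Axiom (iv) is the skew-symmetry `(u, v, e₁₂w) = -(u, e₁₂w, v)`. One of its four terms vanishes,
and the others are the three summands up to sign. -/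
theorem unit_mul_mul_cyclic (hu : IsCayley e u) (hv : IsCayley e v) (hw : IsCayley e w) :
    (e 0 1 * (u * v)) * w + (e 0 1 * (v * w)) * u + (e 0 1 * (w * u)) * v = 0 := by
  have hp := peirce_unit_mul_mul he (u := u) (v := v) hu.peirce hv.peirce
  have hq := peirce_unit_mul_mul he hw.peirce hv.peirce
  have hw' := (Peirce.unit he 0 1).mul_off hw.peirce
  have h := associator_swap_right u v (e 0 1 * w)
  have h1 : (u * v) * (e 0 1 * w) = (e 0 1 * (u * v)) * w := by
    rw [← he.unit_mul_diag_mul_unit_mul hp hw, he.unit_mul_unit_mul_mul hu hv]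
  have h2 : u * (v * (e 0 1 * w)) = 0 :=
    hu.peirce.mul_eq_zero (hv.peirce.mul hw') (by decide) (by decide)
  have h3 : u * ((e 0 1 * w) * v) = (e 0 1 * (w * v)) * u := by
    rw [he.unit_mul_mul_right hw.peirce hv.peirce, ← he.cayley_mul_diag hq hu,
      he.unit_mul_unit_mul_mul hw hv]
  rw [associator, associator, h1, h2, h3, he.mul_unit_mul hu.peirce hw.peirce,
    hu.peirce.mul_comm_neg (by decide) hw.peirce, hw.peirce.mul_comm_neg (by decide) hv.peirce] at h
  simp only [mul_neg, neg_mul, neg_neg] at h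
  rw [sub_zero] at h
  rw [h]
  abel

end IsMatrixUnits

/-- The element of `A` that corresponds to `γ ⊗ eᵢⱼ`. -/
def evenCoord {A : Type*} [Mul A] (e : Fin 2 → Fin 2 → A) (γ : A) (i j : Fin 2) : A :=
  (e i 0 * γ) * e 0 j

/-- The element of `A` that corresponds to `u ⊗ mₖ`. -/
def oddCoord {A : Type*} [Mul A] (e : Fin 2 → Fin 2 → A) (u : A) (k : Fin 2) : A :=
  e 0 k * u

/-! ### Multiplication table of the elements corresponding to `γ ⊗ eᵢⱼ` and `u ⊗ mₖ` -/

namespace IsMatrixUnits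

section

variable {A : Type*} [NonUnitalNonAssocRing A] {e : Fin 2 → Fin 2 → A} {a u : A}

theorem evenCoord_zero_zero (ha : Peirce e 0 0 a) : evenCoord e a 0 0 = a := by
  rw [evenCoord, ha.left, if_pos rfl, ha.right, if_pos rfl]

theorem evenCoord_zero_one (ha : Peirce e 0 0 a) : evenCoord e a 0 1 = a * e 0 1 := by
  rw [evenCoord, ha.left, if_pos rfl]

theorem oddCoord_zero (hu : Peirce e 0 1 u) : oddCoord e u 0 = u := by
  rw [oddCoord, hu.left, if_pos rfl]

theorem oddCoord_one : oddCoord e u 1 = e 0 1 * u := rfl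

end

open IsAlternative

variable {A : Type*} [NonUnitalNonAssocRing A] [IsAlternative A] {e : Fin 2 → Fin 2 → A}
  (he : IsMatrixUnits e) {a b u v w : A}
include he

theorem evenCoord_one_zero (ha : Peirce e 0 0 a) : evenCoord e a 1 0 = e 1 0 * a := by
  rw [evenCoord, ((Peirce.unit he 1 0).mul ha).right, if_pos rfl]

theorem peirce_evenCoord (ha : Peirce e 0 0 a) (i j : Fin 2) :
    Peirce e i j (evenCoord e a i j) :=
  ((Peirce.unit he i 0).mul ha).mul (.unit he 0 j)

theorem evenCoord_one_one (ha : Peirce e 0 0 a) : evenCoord e a 1 1 = e 1 0 * (a * e 0 1) :=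
  (Peirce.unit he 1 0).assoc ha (.unit he 0 1) (by decide)

theorem diag_mul_unit_mul_unit (ha : Peirce e 0 0 a) : (a * e 0 1) * e 1 0 = a := by
  rw [ha.assoc (.unit he 0 1) (.unit he 1 0) (by decide), he, if_pos rfl, ha.right, if_pos rfl]

/-- `Peirce.assoc` does not cover three factors from `e₁₁Ae₁₁`. Writing `c = (c e₁₂)e₂₁` routes
every reassociation through an off-diagonal factor, where it applies. -/
theorem diag_assoc {c : A} (ha : Peirce e 0 0 a) (hb : Peirce e 0 0 b) (hc : Peirce e 0 0 c) :
    (a * b) * c = a * (b * c) := by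
  have hu := Peirce.unit he 0 1
  have hv := Peirce.unit he 1 0
  have hcu := hc.mul hu
  rw [← he.diag_mul_unit_mul_unit hc, ← (ha.mul hb).assoc hcu hv (by decide),
    ha.assoc hb hcu (by decide), ha.assoc (hb.mul hcu) hv (by decide),
    hb.assoc hcu hv (by decide)]

theorem unit_mul_unit_mul_diag (ha : Peirce e 0 0 a) : e 0 1 * (e 1 0 * a) = a := by
  rw [← (Peirce.unit he 0 1).assoc (.unit he 1 0) ha (by decide), he, if_pos rfl, ha.left,
    if_pos rfl]

theorem diag_mul_unit_mul_self (ha : Peirce e 0 0 a) (hb : Peirce e 0 0 b) :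
    (a * e 0 1) * (b * e 0 1) = 0 := by
  have hu := Peirce.unit he 0 1
  rw [diag_mul_off_mul ha hu (hb.mul hu), hu.mul_comm_neg (by decide) (hb.mul hu),
    diag_mul_off_mul hb hu hu, he, if_neg (by decide), zero_mul, neg_zero, zero_mul]

theorem unit_mul_diag_mul_self (ha : Peirce e 0 0 a) (hb : Peirce e 0 0 b) :
    (e 1 0 * a) * (e 1 0 * b) = 0 := by
  have hu := Peirce.unit he 1 0
  have h : e 1 0 * (e 1 0 * b) = 0 := by
    rw [← left_alt, he, if_neg (by decide), zero_mul]
  rw [off_mul_diag_mul ha hu (hu.mul hb), h, mul_zero]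

/-- The factors `e₂₁a, e₁₂, e₂₁` form a pattern excluded from `Peirce.assoc`; here a rotation of the
associator does the work. -/
theorem evenCoord_one_one_mul_unit (ha : Peirce e 0 0 a) :
    evenCoord e a 1 1 * e 1 0 = e 1 0 * a := by
  have h := associator_rotate (e 1 0 * a) (e 0 1) (e 1 0)
  rw [associator, associator, he, if_pos rfl,
    (((Peirce.unit he 1 0).mul ha)).right, if_pos rfl, (((Peirce.unit he 1 0).mul ha)).left,
    if_neg (by decide), ← left_alt, he, if_neg (by decide), zero_mul, mul_zero, sub_zero,
    sub_eq_zero] at h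
  exact h

theorem unit_mul_mul_unit (hu : Peirce e 0 1 u) : (e 0 1 * u) * e 0 1 = 0 := by
  rw [flexible, hu.mul_comm_neg (by decide) (.unit he 0 1), mul_neg, ← left_alt, he,
    if_neg (by decide), zero_mul, neg_zero]

theorem evenCoord_mul_evenCoord (ha : Peirce e 0 0 a) (hb : Peirce e 0 0 b) (i j k l : Fin 2) :
    evenCoord e a i j * evenCoord e b k l = if j = k then evenCoord e (a * b) i l else 0 := by
  have hij := he.peirce_evenCoord ha i j
  have hkl := he.peirce_evenCoord hb k l
  have hu := Peirce.unit he 0 1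
  have hv := Peirce.unit he 1 0
  have key : evenCoord e a 1 1 * (e 1 0 * b) = e 1 0 * (a * b) := by
    rw [← (he.peirce_evenCoord ha 1 1).assoc hv hb (by decide), he.evenCoord_one_one_mul_unit ha,
      hv.assoc ha hb (by decide)]
  have key2 : (e 1 0 * a) * (b * e 0 1) = e 1 0 * ((a * b) * e 0 1) := by
    rw [hv.assoc ha (hb.mul hu) (by decide), ha.assoc hb hu (by decide)]
  by_cases hjk : j = k
  · subst hjk
    rw [if_pos rfl]
    fin_cases i <;> fin_cases j <;> fin_cases l <;>
      simp only [Fin.zero_eta, Fin.mk_one, Fin.isValue, evenCoord_zero_zero ha,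
        evenCoord_zero_zero hb, evenCoord_zero_zero (ha.mul hb), evenCoord_zero_one ha,
        evenCoord_zero_one hb, evenCoord_zero_one (ha.mul hb), he.evenCoord_one_zero ha,
        he.evenCoord_one_zero hb, he.evenCoord_one_zero (ha.mul hb)]
    · rw [ha.assoc hb hu (by decide)]
    · rw [ha.assoc hu (hv.mul hb) (by decide), he.unit_mul_unit_mul_diag hb]
    -- The needed equality `e₁₂(e₂₁(b e₁₂)) = b e₁₂` is again an excluded pattern. Reversing the
    -- associator gives it, since `(b e₁₂, e₂₁, e₁₂) = 0` is computed directly.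
    · have h := associator_reverse (b * e 0 1) (e 1 0) (e 0 1)
      rw [associator, associator, he.diag_mul_unit_mul_unit hb, he, he, if_pos rfl, if_pos rfl,
        (hb.mul hu).left, (hb.mul hu).right, if_pos rfl, if_pos rfl, sub_self, zero_eq_neg,
        sub_eq_zero] at h
      rw [he.evenCoord_one_one hb, ha.assoc hu (hv.mul (hb.mul hu)) (by decide), ← h,
        ha.assoc hb hu (by decide)]
    · rw [hv.assoc ha hb (by decide)]
    · rw [key2, he.evenCoord_one_one (ha.mul hb)]
    · exact key
    · rw [he.evenCoord_one_one (ha.mul hb), he.evenCoord_one_one hb,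
        ← (he.peirce_evenCoord ha 1 1).assoc hv (hb.mul hu) (by decide),
        he.evenCoord_one_one_mul_unit ha, key2]
  · rw [if_neg hjk]
    -- Two factors from the same off-diagonal component are not killed by the Peirce rules; their
    -- product vanishes only because both have the form `γ ⊗ eᵢⱼ`.
    by_cases h : i = k ∧ j = l
    · obtain ⟨rfl, rfl⟩ := h
      fin_cases i <;> fin_cases j <;> simp only [Fin.zero_eta, Fin.mk_one, Fin.isValue] at hjk ⊢
      · exact absurd trivial hjk
      · rw [evenCoord_zero_one ha, evenCoord_zero_one hb, he.diag_mul_unit_mul_self ha hb]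
      · rw [he.evenCoord_one_zero ha, he.evenCoord_one_zero hb, he.unit_mul_diag_mul_self ha hb]
      · exact absurd trivial hjk
    · exact hij.mul_eq_zero hkl hjk h

theorem evenCoord_mul_oddCoord (ha : Peirce e 0 0 a) (hu : IsCayley e u) (i j k : Fin 2) :
    evenCoord e a i j * oddCoord e u k = if i = k then oddCoord e (a * u) j else 0 := by
  have h01 := Peirce.unit he 0 1
  have h10 := Peirce.unit he 1 0
  have hu' := h01.mul_off hu.peirce
  have hau := he.cayley_diag_mul ha hu
  have h1 : (a * e 0 1) * u = e 0 1 * (a * u) := by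
    rw [diag_mul_off_mul_swap ha h01 hu.peirce, hau.peirce.mul_comm_neg (by decide) h01, neg_neg]
  have h2 : (a * e 0 1) * (e 0 1 * u) = 0 := by
    rw [ha.assoc h01 hu' (by decide), ← left_alt, he, if_neg (by decide), zero_mul, mul_zero]
  fin_cases i <;> fin_cases j <;> fin_cases k <;>
    simp only [Fin.zero_eta, Fin.mk_one, Fin.isValue, evenCoord_zero_zero ha,
      evenCoord_zero_one ha, he.evenCoord_one_zero ha, oddCoord_zero hu.peirce,
      oddCoord_zero hau.peirce, oddCoord_one, if_true, zero_ne_one, one_ne_zero, if_false]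
  · exact ha.mul_eq_zero hu' (by decide) (by decide)
  · exact h1
  · exact h2
  · rw [h10.assoc ha hu.peirce (by decide), he.unit_mul_cayley hau]
  · exact he.unit_mul_diag_mul_unit_mul ha hu
  · exact (he.peirce_evenCoord ha 1 1).mul_eq_zero hu.peirce (by decide) (by decide)
  · have h := associator_swap_left (e 1 0) (a * e 0 1) (e 0 1 * u)
    rw [associator, associator, h2, mul_zero, sub_zero, he.diag_mul_unit_mul_unit ha,
      ha.mul_eq_zero hu' (by decide) (by decide), he.unit_mul_unit_mul_cayley hu, zero_sub,
      neg_neg, h1] at h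
    rw [he.evenCoord_one_one ha, h]

/-- Right multiplication is left multiplication by the adjugate. The adjugate exchanges `e₁₁` with
`e₂₂`, so the nonzero case is `i ≠ k`, and it negates `e₁₂` and `e₂₁`, which is why off-diagonal
units are treated separately. -/
theorem oddCoord_mul_evenCoord_diag (ha : Peirce e 0 0 a) (hu : IsCayley e u) (i k : Fin 2) :
    oddCoord e u k * evenCoord e a i i = if i = k then 0 else oddCoord e (a * u) k := by
  have hu' := (Peirce.unit he 0 1).mul_off hu.peirce
  have hau := he.cayley_diag_mul ha hu
  fin_cases i <;> fin_cases k <;>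
    simp only [Fin.zero_eta, Fin.mk_one, Fin.isValue, evenCoord_zero_zero ha,
      oddCoord_zero hu.peirce, oddCoord_zero hau.peirce, oddCoord_one, if_true, zero_ne_one,
      one_ne_zero, if_false]
  · exact hu.peirce.mul_eq_zero ha (by decide) (by decide)
  · exact (he.unit_mul_diag_mul ha hu.peirce).symm
  · exact he.cayley_mul_diag ha hu
  · exact hu'.mul_eq_zero (he.peirce_evenCoord ha 1 1) (by decide) (by decide)

theorem oddCoord_mul_evenCoord_off (ha : Peirce e 0 0 a) (hu : IsCayley e u) {i j : Fin 2}
    (hij : i ≠ j) (k : Fin 2) :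
    oddCoord e u k * evenCoord e a i j = -(if i = k then oddCoord e (a * u) j else 0) := by
  have h01 := Peirce.unit he 0 1
  have h10 := Peirce.unit he 1 0
  have hu' := h01.mul_off hu.peirce
  have hau := he.cayley_diag_mul ha hu
  fin_cases i <;> fin_cases j <;> fin_cases k <;>
    simp only [Fin.zero_eta, Fin.mk_one, Fin.isValue, ne_eq, not_true_eq_false,
      evenCoord_zero_one ha, he.evenCoord_one_zero ha, oddCoord_zero hu.peirce, oddCoord_zero hau.peirce, oddCoord_one,
      if_true, zero_ne_one, one_ne_zero, if_false, neg_zero] at hij ⊢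
  · rw [hu.peirce.mul_comm_neg (by decide) (ha.mul h01), diag_mul_off_mul_swap ha h01 hu.peirce,
      hau.peirce.mul_comm_neg (by decide) h01, neg_neg]
  · rw [← hu'.assoc ha h01 (by decide), ← he.unit_mul_diag_mul ha hu.peirce,
      he.unit_mul_mul_unit hau.peirce]
  · exact he.cayley_mul_unit_mul_diag ha hu
  · rw [hu'.mul_comm_neg (by decide) (h10.mul ha), he.unit_mul_diag_mul_unit_mul ha hu]

theorem oddCoord_mul_oddCoord (hu : IsCayley e u) (hv : IsCayley e v) :
    oddCoord e u 0 * oddCoord e v 0 = evenCoord e (e 0 1 * (u * v)) 1 0 ∧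
    oddCoord e u 1 * oddCoord e v 1 = -evenCoord e (e 0 1 * (u * v)) 0 1 ∧
    oddCoord e u 0 * oddCoord e v 1 = -evenCoord e (e 0 1 * (u * v)) 0 0 ∧
    oddCoord e u 1 * oddCoord e v 0 = evenCoord e (e 0 1 * (u * v)) 1 1 := by
  have h01 := Peirce.unit he 0 1
  have hp := he.peirce_unit_mul_mul hu.peirce hv.peirce
  have hu' := h01.mul_off hu.peirce
  rw [oddCoord_zero hu.peirce, oddCoord_zero hv.peirce, oddCoord_one, oddCoord_one,
    evenCoord_zero_zero hp, evenCoord_zero_one hp, he.evenCoord_one_zero hp, evenCoord,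
    he.unit_mul_unit_mul_mul hu hv]
  refine ⟨rfl, ?_, he.mul_unit_mul hu.peirce hv.peirce, he.unit_mul_mul_right hu.peirce hv.peirce⟩
  have h := associator_rotate v (e 0 1 * u) (e 0 1)
  rw [associator, associator, he.unit_mul_mul_unit hu.peirce, zero_mul, mul_zero, sub_zero, zero_sub,
    he.mul_unit_mul hv.peirce hu.peirce, hv.peirce.mul_comm_neg (by decide) hu.peirce, mul_neg,
    neg_neg] at h
  rw [h, neg_neg]

end IsMatrixUnits

/-! ### The `Γ`-algebra of coordinates of an alternative algebra with matrix units -/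

section Coordinates

variable (F : Type*) [Field F] {A : Type*} [NonUnitalNonAssocRing A]
  [Module F A] [IsScalarTower F A A] [SMulCommClass F A A] {e : Fin 2 → Fin 2 → A}

/-- The Peirce component `e₁₁ A e₁₁`. -/
def peirceDiag (e : Fin 2 → Fin 2 → A) : Submodule F A where
  carrier := {x | Peirce e 0 0 x}
  zero_mem' := Peirce.zero 0 0
  add_mem' := Peirce.add
  smul_mem' c _ := Peirce.smul c

/-- The subspace of the elements that correspond to the vectors `γ ⊗ m₁`. -/
def cayleySubmodule (e : Fin 2 → Fin 2 → A) : Submodule F A where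
  carrier := {x | IsCayley e x}
  zero_mem' := ⟨Peirce.zero 0 1, zero_mul _⟩
  add_mem' hx hy := ⟨hx.peirce.add hy.peirce, by rw [add_mul, hx.mul_unit, hy.mul_unit, add_zero]⟩
  smul_mem' c _ hx := ⟨hx.peirce.smul c, by rw [smul_mul_assoc, hx.mul_unit, smul_zero]⟩

/-- The `Γ`-algebra of coordinates. -/
@[ext]
structure CoordAlgebra (he : IsMatrixUnits e) where
  even : peirceDiag F e
  odd : cayleySubmodule F e

namespace CoordAlgebra

variable {F} (he : IsMatrixUnits e)

/-- As a vector space, the algebra of coordinates is a product. -/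
def equivProd : CoordAlgebra F he ≃ peirceDiag F e × cayleySubmodule F e where
  toFun x := (x.even, x.odd)
  invFun x := ⟨x.1, x.2⟩

instance : AddCommGroup (CoordAlgebra F he) := (equivProd he).addCommGroup

instance : Module F (CoordAlgebra F he) := (equivProd he).module F

instance : One (CoordAlgebra F he) where
  one := ⟨⟨e 0 0, Peirce.unit he 0 0⟩, 0⟩

variable {he}

@[simp] theorem even_zero : (0 : CoordAlgebra F he).even = 0 := rfl
@[simp] theorem odd_zero : (0 : CoordAlgebra F he).odd = 0 := rfl
@[simp] theorem even_one : ((1 : CoordAlgebra F he).even : A) = e 0 0 := rfl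
@[simp] theorem odd_one : (1 : CoordAlgebra F he).odd = 0 := rfl
@[simp] theorem even_add (x y : CoordAlgebra F he) : (x + y).even = x.even + y.even := rfl
@[simp] theorem odd_add (x y : CoordAlgebra F he) : (x + y).odd = x.odd + y.odd := rfl
@[simp] theorem even_smul (c : F) (x : CoordAlgebra F he) : (c • x).even = c • x.even := rfl
@[simp] theorem odd_smul (c : F) (x : CoordAlgebra F he) : (c • x).odd = c • x.odd := rfl
theorem ext' {x y : CoordAlgebra F he} (h0 : (x.even : A) = y.even) (h1 : (x.odd : A) = y.odd) :
    x = y :=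
  CoordAlgebra.ext (Subtype.ext h0) (Subtype.ext h1)

variable [IsAlternative A]

-- Even coefficients stand on the left in both odd terms, as `[Γ₀, Γ₁] = 0` demands; the product of
-- `A` itself is zero on `Γ₁ × Γ₀`. The factor `e₁₂` moves `uv` from `e₂₂Ae₁₁` to `e₁₁Ae₁₁`.
variable (he) in
instance : Mul (CoordAlgebra F he) where
  mul x y :=
    ⟨⟨x.even * y.even + e 0 1 * (x.odd * y.odd),
      (x.even.2.mul y.even.2).add (he.peirce_unit_mul_mul x.odd.2.peirce y.odd.2.peirce)⟩,
    ⟨x.even * y.odd + y.even * x.odd,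
      add_mem (he.cayley_diag_mul x.even.2 y.odd.2) (he.cayley_diag_mul y.even.2 x.odd.2)⟩⟩

@[simp] theorem even_mul (x y : CoordAlgebra F he) :
    ((x * y).even : A) = x.even * y.even + e 0 1 * (x.odd * y.odd) := rfl
@[simp] theorem odd_mul (x y : CoordAlgebra F he) :
    ((x * y).odd : A) = x.even * y.odd + y.even * x.odd := rfl

instance : NonAssocRing (CoordAlgebra F he) where
  left_distrib x y z := by
    apply ext' <;> simp [mul_add, add_mul] <;> abel
  right_distrib x y z := by
    apply ext' <;> simp [mul_add, add_mul] <;> abel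
  zero_mul x := by apply ext' <;> simp
  mul_zero x := by apply ext' <;> simp
  one_mul x := by
    apply ext'
    · simp [x.even.2.left]
    · simp [x.odd.2.peirce.left]
  mul_one x := by
    apply ext'
    · simp [x.even.2.right]
    · simp [x.odd.2.peirce.left]

instance : IsScalarTower F (CoordAlgebra F he) (CoordAlgebra F he) where
  smul_assoc c x y := by
    apply ext' <;> simp [smul_mul_assoc, mul_smul_comm]

instance : SMulCommClass F (CoordAlgebra F he) (CoordAlgebra F he) where
  smul_comm c x y := by
    apply ext' <;> simp [smul_mul_assoc, mul_smul_comm]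

variable (F he) in
/-- The grading of the algebra of coordinates. -/
def grading (i : ZMod 2) : Submodule F (CoordAlgebra F he) where
  carrier := {x | (i = 0 → x.odd = 0) ∧ (i = 1 → x.even = 0)}
  zero_mem' := by simp
  add_mem' {x y} hx hy :=
    ⟨fun h => by simp [hx.1 h, hy.1 h], fun h => by simp [hx.2 h, hy.2 h]⟩
  smul_mem' c x hx := ⟨fun h => by simp [hx.1 h], fun h => by simp [hx.2 h]⟩

theorem mem_grading_zero {x : CoordAlgebra F he} : x ∈ grading F he 0 ↔ x.odd = 0 := by
  change ((0 : ZMod 2) = 0 → x.odd = 0) ∧ ((0 : ZMod 2) = 1 → x.even = 0) ↔ _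
  simp

theorem mem_grading_one {x : CoordAlgebra F he} : x ∈ grading F he 1 ↔ x.even = 0 := by
  change ((1 : ZMod 2) = 0 → x.odd = 0) ∧ ((1 : ZMod 2) = 1 → x.even = 0) ↔ _
  simp

theorem isSuperalgebra : IsSuperalgebra (grading F he) where
  isCompl := by
    constructor
    · rw [Submodule.disjoint_def]
      intro x h0 h1
      exact CoordAlgebra.ext (mem_grading_one.1 h1) (mem_grading_zero.1 h0)
    · rw [codisjoint_iff, eq_top_iff]
      intro x _
      refine Submodule.mem_sup.2 ⟨⟨x.even, 0⟩, mem_grading_zero.2 rfl, ⟨0, x.odd⟩,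
        mem_grading_one.2 rfl, ?_⟩
      ext <;> simp
  mul_mem {i j x y} hx hy := by
    fin_cases i <;> fin_cases j
    · have hx := mem_grading_zero.1 hx
      have hy := mem_grading_zero.1 hy
      exact mem_grading_zero.2 (Subtype.ext (by simp [hx, hy]))
    · have hx := mem_grading_zero.1 hx
      have hy := mem_grading_one.1 hy
      exact mem_grading_one.2 (Subtype.ext (by simp [hx, hy]))
    · have hx := mem_grading_one.1 hx
      have hy := mem_grading_zero.1 hy
      exact mem_grading_one.2 (Subtype.ext (by simp [hx, hy]))
    · have hx := mem_grading_one.1 hx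
      have hy := mem_grading_one.1 hy
      exact mem_grading_zero.2 (Subtype.ext (by simp [hx, hy]))

/-- Each axiom is one of the identities between Peirce components. In `assoc`, the odd part needs
the commuting left action, since an even right factor of an odd element acts from the left. -/
theorem isGammaAlgebra : IsGammaAlgebra (grading F he) where
  toIsSuperalgebra := isSuperalgebra
  one_mem := mem_grading_zero.2 rfl
  comm a ha x hx := by
    rw [mem_grading_zero] at ha
    rw [mem_grading_one] at hx
    apply ext' <;> simp [ha, hx]
  assoc a ha b c := by
    rw [mem_grading_zero] at ha
    apply ext'
    · simp [ha, mul_add, he.unit_mul_diag_mul_mul a.even.2 b.odd.2.peirce c.odd.2.peirce,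
        he.diag_assoc a.even.2 b.even.2 c.even.2]
    · simp [ha, mul_add, he.diag_mul_diag_mul_cayley a.even.2 c.even.2 b.odd.2,
        a.even.2.assoc c.even.2 b.odd.2.peirce (by decide),
        a.even.2.assoc b.even.2 c.odd.2.peirce (by decide)]
  center x hx y hy a ha := by
    rw [mem_grading_zero] at ha
    rw [mem_grading_one] at hx hy
    apply ext'
    · simpa [ha, hx, hy] using
        he.unit_mul_mul_diag a.even.2 x.odd.2.peirce y.odd.2.peirce
    · simp [ha, hx, hy]
  skew x hx y hy := by
    rw [mem_grading_one] at hx hy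
    apply ext'
    · simp [hx, hy, x.odd.2.peirce.mul_comm_neg (by decide) y.odd.2.peirce]
    · simp [hx, hy]
  sq_zero x hx := by
    rw [mem_grading_one] at hx
    apply ext'
    · simp [hx, x.odd.2.peirce.mul_self_eq_zero (by decide)]
    · simp [hx]
  cyclic x hx y hy z hz := by
    rw [mem_grading_one] at hx hy hz
    apply ext'
    · simp [hx, hy, hz]
    · simpa [hx, hy, hz] using he.unit_mul_mul_cyclic x.odd.2 y.odd.2 z.odd.2

end CoordAlgebra

end Coordinates

/-! ### The envelope of a `Γ`-algebra is alternative -/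

section Span

variable {F : Type*} [Field F] {M N : Type*} [AddCommGroup M] [Module F M] [AddCommGroup N]
  [Module F N]

/-- In characteristic 2 the polarized identity does not imply the diagonal one, so both are required
on the spanning set. -/
theorem alternating_of_span (Q : M →ₗ[F] M →ₗ[F] N) {S : Set M} (h : ∀ s ∈ S, Q s s = 0)
    (h' : ∀ s ∈ S, ∀ t ∈ S, Q s t + Q t s = 0) {x : M} (hx : x ∈ Submodule.span F S) :
    Q x x = 0 := by
  have key : ∀ x ∈ Submodule.span F S, ∀ y ∈ Submodule.span F S, Q x y + Q y x = 0 := by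
    intro x hx y hy
    induction hx, hy using Submodule.span_induction₂ with
    | mem_mem x y hx hy => exact h' x hx y hy
    | zero_left y hy => simp
    | zero_right x hx => simp
    | add_left x y z _ _ _ h1 h2 =>
      rw [map_add, map_add, LinearMap.add_apply, add_add_add_comm, h1, h2, add_zero]
    | add_right x y z _ _ _ h1 h2 =>
      rw [map_add, map_add, LinearMap.add_apply, add_add_add_comm, h1, h2, add_zero]
    | smul_left c x y _ _ h1 =>
      rw [map_smul, map_smul, LinearMap.smul_apply, ← smul_add, h1, smul_zero]
    | smul_right c x y _ _ h1 =>
      rw [map_smul, map_smul, LinearMap.smul_apply, ← smul_add, h1, smul_zero]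
  induction hx using Submodule.span_induction with
  | mem x hx => exact h x hx
  | zero => simp
  | add x y hx hy h1 h2 =>
    have := key x hx y hy
    rw [map_add, map_add, LinearMap.add_apply, LinearMap.add_apply, h1, h2, add_zero, zero_add,
      add_comm, this]
  | smul c x _ h1 => rw [map_smul, map_smul, LinearMap.smul_apply, h1, smul_zero, smul_zero]

variable {A : Type*} [NonUnitalNonAssocRing A] [Module F A] [IsScalarTower F A A]
  [SMulCommClass F A A]

theorem left_alt_of_span {S : Set A} (h : ∀ s ∈ S, ∀ y ∈ S, associator s s y = 0)
    (h' : ∀ s ∈ S, ∀ t ∈ S, ∀ y ∈ S, associator s t y + associator t s y = 0) {x y : A}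
    (hx : x ∈ Submodule.span F S) (hy : y ∈ Submodule.span F S) : associator x x y = 0 := by
  have key : ∀ y ∈ S, associator x x y = 0 := fun y hy =>
    alternating_of_span (LinearMap.mk₂ F (fun x x' => associator x x' y)
      (by intros; simp only [associator, add_mul]; abel)
      (by intros; simp only [associator, smul_mul_assoc, smul_sub])
      (by intros; simp only [associator, add_mul, mul_add]; abel)
      (by intros; simp only [associator, smul_mul_assoc, mul_smul_comm, smul_sub]))
      (fun s hs => h s hs y hy) (fun s hs t ht => h' s hs t ht y hy) hx
  induction hy using Submodule.span_induction with
  | mem y hy => exact key y hy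
  | zero => simp [associator]
  | add y z _ _ h1 h2 =>
    rw [← add_zero (0 : A)]
    nth_rewrite 1 [← h1]
    rw [← h2]
    simp only [associator, mul_add]
    abel
  | smul c y _ h1 =>
    rw [← smul_zero c, ← h1]
    simp only [associator, mul_smul_comm, smul_sub]

theorem right_alt_of_span {S : Set A} (h : ∀ s ∈ S, ∀ y ∈ S, associator y s s = 0)
    (h' : ∀ s ∈ S, ∀ t ∈ S, ∀ y ∈ S, associator y s t + associator y t s = 0) {x y : A}
    (hx : x ∈ Submodule.span F S) (hy : y ∈ Submodule.span F S) : associator y x x = 0 := by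
  have key : ∀ y ∈ S, associator y x x = 0 := fun y hy =>
    alternating_of_span (LinearMap.mk₂ F (fun x x' => associator y x x')
      (by intros; simp only [associator, add_mul, mul_add]; abel)
      (by intros; simp only [associator, smul_mul_assoc, mul_smul_comm, smul_sub])
      (by intros; simp only [associator, mul_add]; abel)
      (by intros; simp only [associator, mul_smul_comm, smul_sub]))
      (fun s hs => h s hs y hy) (fun s hs t ht => h' s hs t ht y hy) hx
  induction hy using Submodule.span_induction with
  | mem y hy => exact key y hy
  | zero => simp [associator]
  | add y z _ _ h1 h2 =>
    rw [← add_zero (0 : A)]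
    nth_rewrite 1 [← h1]
    rw [← h2]
    simp only [associator, add_mul]
    abel
  | smul c y _ h1 =>
    rw [← smul_zero c, ← h1]
    simp only [associator, smul_mul_assoc, smul_sub]

end Span

/-! ### Envelopes as spans of homogeneous tensors -/

section EnvelopeSpan

variable {F : Type*} [Field F]
  {A : Type*} [NonUnitalNonAssocRing A] [Module F A]
  {B : Type*} [NonUnitalNonAssocRing B] [Module F B]
  {𝒜 : ZMod 2 → Submodule F A} {ℬ : ZMod 2 → Submodule F B}

/-- The tensors `a ⊗ b` of homogeneous elements of the same parity. -/
def homogeneousTensors (𝒜 : ZMod 2 → Submodule F A) (ℬ : ZMod 2 → Submodule F B) :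
    Set (A ⊗[F] B) :=
  {t | ∃ i : ZMod 2, ∃ a ∈ 𝒜 i, ∃ b ∈ ℬ i, t = a ⊗ₜ[F] b}

theorem mem_homogeneousTensors {t : A ⊗[F] B} (h : t ∈ homogeneousTensors 𝒜 ℬ) :
    (∃ a ∈ 𝒜 0, ∃ b ∈ ℬ 0, t = a ⊗ₜ[F] b) ∨ ∃ a ∈ 𝒜 1, ∃ b ∈ ℬ 1, t = a ⊗ₜ[F] b := by
  obtain ⟨i, h⟩ := h
  fin_cases i
  · exact Or.inl h
  · exact Or.inr h

variable [IsScalarTower F A A] [SMulCommClass F A A] [IsScalarTower F B B] [SMulCommClass F B B]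

theorem mem_envelope_iff (hA : IsSuperalgebra 𝒜) (hB : IsSuperalgebra ℬ) {x : A ⊗[F] B} :
    x ∈ envelope hA hB ↔ x ∈ Submodule.span F (homogeneousTensors 𝒜 ℬ) := by
  change x ∈ (⨆ i : ZMod 2, Submodule.map₂ (TensorProduct.mk F A B) (𝒜 i) (ℬ i)) ↔ _
  refine ⟨fun h => ?_, fun h => ?_⟩
  · refine (iSup_le fun i => Submodule.map₂_le.2 fun a ha b hb => ?_ :
      (⨆ i : ZMod 2, Submodule.map₂ (TensorProduct.mk F A B) (𝒜 i) (ℬ i)) ≤ _) h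
    exact Submodule.subset_span ⟨i, a, ha, b, hb, rfl⟩
  · refine (Submodule.span_le.2 ?_ : Submodule.span F (homogeneousTensors 𝒜 ℬ) ≤ _) h
    rintro _ ⟨i, a, ha, b, hb, rfl⟩
    exact tmul_mem_envelope hA hB ha hb

/-- A linear map that is multiplicative on homogeneous tensors is a homomorphism on the
envelope. -/
def envelopeLift {C : Type*} [NonUnitalNonAssocRing C] [Module F C] [IsScalarTower F C C]
    [SMulCommClass F C C] (hA : IsSuperalgebra 𝒜) (hB : IsSuperalgebra ℬ) (f : A ⊗[F] B →ₗ[F] C)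
    (hf : ∀ s ∈ homogeneousTensors 𝒜 ℬ, ∀ t ∈ homogeneousTensors 𝒜 ℬ, f (s * t) = f s * f t) :
    envelope hA hB →ₙₐ[F] C where
  toFun x := f x
  map_smul' c x := by simp
  map_zero' := by simp
  map_add' x y := by simp
  map_mul' x y := by
    obtain ⟨x, hx⟩ := x
    obtain ⟨y, hy⟩ := y
    have hx' := (mem_envelope_iff hA hB).1 hx
    have hy' := (mem_envelope_iff hA hB).1 hy
    change f (x * y) = f x * f y
    clear hx hy
    induction hx', hy' using Submodule.span_induction₂ with
    | mem_mem x y hx hy => exact hf x hx y hy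
    | zero_left y hy => simp
    | zero_right x hx => simp
    | add_left x y z _ _ _ h1 h2 => rw [add_mul, map_add, map_add, add_mul, h1, h2]
    | add_right x y z _ _ _ h1 h2 => rw [mul_add, map_add, map_add, mul_add, h1, h2]
    | smul_left c x y _ _ h1 => rw [smul_mul_assoc, map_smul, map_smul, smul_mul_assoc, h1]
    | smul_right c x y _ _ h1 => rw [mul_smul_comm, map_smul, map_smul, mul_smul_comm, h1]

end EnvelopeSpan

/-! ### Products of two and three homogeneous elements of a `Γ`-algebra -/

namespace IsGammaAlgebra

variable {F : Type*} [Field F] {Γ : Type*} [NonAssocRing Γ] [Module F Γ]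
  {𝒢 : ZMod 2 → Submodule F Γ} (h : IsGammaAlgebra 𝒢) {a b u v w : Γ}
include h

theorem mul_mem_even (ha : a ∈ 𝒢 0) (hb : b ∈ 𝒢 0) : a * b ∈ 𝒢 0 := by
  simpa using h.mul_mem ha hb

theorem even_mul_odd_mem (ha : a ∈ 𝒢 0) (hu : u ∈ 𝒢 1) : a * u ∈ 𝒢 1 := by
  simpa using h.mul_mem ha hu

theorem odd_mul_odd_mem (hu : u ∈ 𝒢 1) (hv : v ∈ 𝒢 1) : u * v ∈ 𝒢 0 := by
  have := h.mul_mem hu hv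
  rwa [show (1 : ZMod 2) + 1 = 0 by decide] at this

theorem mul_swap (hu : u ∈ 𝒢 1) (hv : v ∈ 𝒢 1) : u * v = -(v * u) :=
  eq_neg_of_add_eq_zero_left (h.skew u hu v hv)

/-- All products of two even elements and an odd one are equal. -/
theorem products_one_odd (ha : a ∈ 𝒢 0) (hb : b ∈ 𝒢 0) (hu : u ∈ 𝒢 1) :
    b * a * u = a * b * u ∧ a * (b * u) = a * b * u ∧ b * (a * u) = a * b * u ∧
    a * u * b = a * b * u ∧ a * (u * b) = a * b * u ∧ b * u * a = a * b * u ∧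
    b * (u * a) = a * b * u ∧ u * a * b = a * b * u ∧ u * (a * b) = a * b * u ∧
    u * b * a = a * b * u ∧ u * (b * a) = a * b * u := by
  have hau := h.even_mul_odd_mem ha hu
  have hbu := h.even_mul_odd_mem hb hu
  have h1 := h.assoc a ha b u
  have h2 := h.assoc b hb a u
  have h3 : b * a * u = a * b * u := by
    rw [h2, h1, h.comm b hb _ hau, h.assoc a ha, ← h.comm b hb u hu]
  rw [← h.comm a ha u hu, ← h.comm b hb u hu, ← h.comm b hb _ hau, ← h.comm a ha _ hbu,
    ← h.comm _ (h.mul_mem_even ha hb) u hu, ← h.comm _ (h.mul_mem_even hb ha) u hu, ← h1, ← h2, h3]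
  simp

/-- The products of an even element and two odd ones are equal up to sign. -/
theorem products_two_odd (ha : a ∈ 𝒢 0) (hu : u ∈ 𝒢 1) (hv : v ∈ 𝒢 1) :
    a * u * v = a * (u * v) ∧ u * a * v = a * (u * v) ∧ u * (a * v) = a * (u * v) ∧
    u * (v * a) = a * (u * v) ∧ u * v * a = a * (u * v) ∧ a * (v * u) = -(a * (u * v)) ∧
    a * v * u = -(a * (u * v)) ∧ v * a * u = -(a * (u * v)) ∧ v * (a * u) = -(a * (u * v)) ∧
    v * (u * a) = -(a * (u * v)) ∧ v * u * a = -(a * (u * v)) := by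
  rw [← h.comm a ha u hu, ← h.comm a ha v hv, h.mul_swap hu (h.even_mul_odd_mem ha hv),
    h.mul_swap hv (h.even_mul_odd_mem ha hu), h.center u hu v hv a ha, h.center v hv u hu a ha,
    h.assoc a ha, h.assoc a ha, h.mul_swap hv hu]
  simp

/-- The products of three odd elements, in terms of two of them. -/
theorem products_three_odd (hu : u ∈ 𝒢 1) (hv : v ∈ 𝒢 1) (hw : w ∈ 𝒢 1) :
    v * u * w = -(u * v * w) ∧ w * v * u = -(v * w * u) ∧
    w * u * v = -(u * v * w + v * w * u) ∧ u * w * v = u * v * w + v * w * u ∧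
    u * (v * w) = v * w * u ∧ u * (w * v) = -(v * w * u) ∧ v * (u * w) = u * v * w + v * w * u ∧
    v * (w * u) = -(u * v * w + v * w * u) ∧ w * (u * v) = u * v * w ∧
    w * (v * u) = -(u * v * w) := by
  have h1 : w * u * v = -(u * v * w + v * w * u) :=
    eq_neg_of_add_eq_zero_right (h.cyclic u hu v hv w hw)
  rw [← h.comm _ (h.odd_mul_odd_mem hv hw) u hu, ← h.comm _ (h.odd_mul_odd_mem hw hv) u hu,
    ← h.comm _ (h.odd_mul_odd_mem hu hw) v hv, ← h.comm _ (h.odd_mul_odd_mem hw hu) v hv,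
    ← h.comm _ (h.odd_mul_odd_mem hu hv) w hw, ← h.comm _ (h.odd_mul_odd_mem hv hu) w hw,
    h.mul_swap hv hu, h.mul_swap hw hv, h.mul_swap hu hw]
  simp only [neg_mul, h1]
  simp

end IsGammaAlgebra

/-! ### Associator identities of `B(4,2)`, by parity -/

namespace B42

theorem ext_of_entries {F : Type*} {x y : B42 F} (h00 : x.even 0 0 = y.even 0 0)
    (h01 : x.even 0 1 = y.even 0 1) (h10 : x.even 1 0 = y.even 1 0)
    (h11 : x.even 1 1 = y.even 1 1) (h0 : x.odd 0 = y.odd 0) (h1 : x.odd 1 = y.odd 1) : x = y := by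
  ext i j
  · fin_cases i <;> fin_cases j <;> assumption
  · fin_cases i <;> assumption

variable {F : Type*} [Field F] {a b x y z : B42 F}

theorem even_sub (x y : B42 F) : (x - y).even = x.even - y.even := rfl
theorem odd_sub (x y : B42 F) : (x - y).odd = x.odd - y.odd := rfl

theorem even_mul_zero_zero (x y : B42 F) : (x * y).even 0 0 =
    x.even 0 0 * y.even 0 0 + x.even 0 1 * y.even 1 0 - x.odd 0 * y.odd 1 := by
  simp [cayMul, Matrix.mul_apply, Fin.sum_univ_two, sub_eq_add_neg]

theorem even_mul_zero_one (x y : B42 F) : (x * y).even 0 1 =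
    x.even 0 0 * y.even 0 1 + x.even 0 1 * y.even 1 1 - x.odd 1 * y.odd 1 := by
  simp [cayMul, Matrix.mul_apply, Fin.sum_univ_two, sub_eq_add_neg]

theorem even_mul_one_zero (x y : B42 F) : (x * y).even 1 0 =
    x.even 1 0 * y.even 0 0 + x.even 1 1 * y.even 1 0 + x.odd 0 * y.odd 0 := by
  simp [cayMul, Matrix.mul_apply, Fin.sum_univ_two]

theorem even_mul_one_one (x y : B42 F) : (x * y).even 1 1 =
    x.even 1 0 * y.even 0 1 + x.even 1 1 * y.even 1 1 + x.odd 1 * y.odd 0 := by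
  simp [cayMul, Matrix.mul_apply, Fin.sum_univ_two]

theorem odd_mul_zero (x y : B42 F) : (x * y).odd 0 =
    y.odd 0 * x.even 0 0 + y.odd 1 * x.even 1 0 +
      (x.odd 0 * y.even 1 1 - x.odd 1 * y.even 1 0) := by
  rw [odd_mul, Pi.add_apply, Matrix.adjugate_fin_two]
  simp only [Matrix.vecMul, dotProduct, Fin.sum_univ_two, Matrix.of_apply, Matrix.cons_val_zero,
    Matrix.cons_val_one]
  ring

theorem odd_mul_one (x y : B42 F) : (x * y).odd 1 =
    y.odd 0 * x.even 0 1 + y.odd 1 * x.even 1 1 +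
      (x.odd 1 * y.even 0 0 - x.odd 0 * y.even 0 1) := by
  rw [odd_mul, Pi.add_apply, Matrix.adjugate_fin_two]
  simp only [Matrix.vecMul, dotProduct, Fin.sum_univ_two, Matrix.of_apply, Matrix.cons_val_zero,
    Matrix.cons_val_one]
  ring

section OneOdd

variable (ha : a.odd = 0) (hb : b.odd = 0) (hx : x.even = 0)
include ha hx

theorem associator_one_odd_self : associator a a x = 0 ∧ associator x a a = 0 := by
  refine ⟨?_, ?_⟩ <;> apply ext_of_entries <;>
    simp only [associator, even_sub, odd_sub, even_zero, odd_zero, Matrix.sub_apply, Pi.sub_apply,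
      even_mul_zero_zero, even_mul_zero_one, even_mul_one_zero, even_mul_one_one, odd_mul_zero,
      odd_mul_one, ha, hx, Matrix.zero_apply, Pi.zero_apply] <;> ring

include hb

theorem associator_one_odd :
    associator a b x + associator b a x = 0 ∧ associator a x b + associator x a b = 0 ∧
    associator x a b + associator x b a = 0 ∧ associator a b x + associator a x b = 0 := by
  refine ⟨?_, ?_, ?_, ?_⟩ <;> apply ext_of_entries <;>
    simp only [associator, even_sub, odd_sub, even_zero, odd_zero, Matrix.sub_apply, Pi.sub_apply,
      even_add, odd_add, Matrix.add_apply, Pi.add_apply,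
      even_mul_zero_zero, even_mul_zero_one, even_mul_one_zero, even_mul_one_one, odd_mul_zero,
      odd_mul_one, ha, hb, hx, Matrix.zero_apply, Pi.zero_apply] <;> ring

end OneOdd

/-- Exchanging two odd coefficients in `Γ` costs a sign. Skew-symmetry in the envelope therefore
becomes symmetry in the two odd arguments here, while exchanging an even and an odd argument stays
skew. -/
theorem associator_two_odd (ha : a.odd = 0) (hx : x.even = 0) (hy : y.even = 0) :
    associator x y a = associator y x a ∧ associator a x y + associator x a y = 0 ∧
    associator a x y = associator a y x ∧ associator x a y + associator x y a = 0 := by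
  refine ⟨?_, ?_, ?_, ?_⟩ <;> apply ext_of_entries <;>
    simp only [associator, even_sub, odd_sub, even_zero, odd_zero, Matrix.sub_apply, Pi.sub_apply,
      even_add, odd_add, Matrix.add_apply, Pi.add_apply,
      even_mul_zero_zero, even_mul_zero_one, even_mul_one_zero, even_mul_one_one, odd_mul_zero,
      odd_mul_one, ha, hx, hy, Matrix.zero_apply, Pi.zero_apply] <;> ring

theorem products_two_odd_self (hx : x.even = 0) (hy : y.even = 0) :
    x * (x * y) = 0 ∧ y * x * x = 0 := by
  refine ⟨?_, ?_⟩ <;> apply ext_of_entries <;>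
    simp only [even_zero, odd_zero,
      even_mul_zero_zero, even_mul_zero_one, even_mul_one_zero, even_mul_one_one, odd_mul_zero,
      odd_mul_one, hx, hy, Matrix.zero_apply, Pi.zero_apply] <;> ring

/-- By the cyclic identity, all products of three odd elements `u, v, w` of `Γ` are combinations of
`(uv)w` and `(vw)u`. These four identities say that the `B(4,2)`-coefficients of these two products
cancel in the polarized alternative laws. -/
theorem products_three_odd (hx : x.even = 0) (hy : y.even = 0) (hz : z.even = 0) :
    y * (x * z) = x * y * z - y * x * z ∧ x * (y * z) + y * (x * z) = 0 ∧
    x * y * z + x * z * y = 0 ∧ x * z * y = x * (y * z) - x * (z * y) := by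
  refine ⟨?_, ?_, ?_, ?_⟩ <;> apply ext_of_entries <;>
    simp only [even_sub, odd_sub, even_zero, odd_zero, Matrix.sub_apply, Pi.sub_apply,
      even_add, odd_add, Matrix.add_apply, Pi.add_apply,
      even_mul_zero_zero, even_mul_zero_one, even_mul_one_zero, even_mul_one_one, odd_mul_zero,
      odd_mul_one, hx, hy, hz, Matrix.zero_apply, Pi.zero_apply] <;> ring

end B42

theorem associator_tmul {F : Type*} [Field F] {A B : Type*}
    [NonUnitalNonAssocRing A] [Module F A] [IsScalarTower F A A] [SMulCommClass F A A]
    [NonUnitalNonAssocRing B] [Module F B] [IsScalarTower F B B] [SMulCommClass F B B]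
    (a a' a'' : A) (b b' b'' : B) :
    associator (a ⊗ₜ[F] b) (a' ⊗ₜ[F] b') (a'' ⊗ₜ[F] b'') =
      (a * a' * a'') ⊗ₜ[F] (b * b' * b'') - (a * (a' * a'')) ⊗ₜ[F] (b * (b' * b'')) := by
  simp only [associator, Algebra.TensorProduct.tmul_mul_tmul]

/-! ### Alternative laws for homogeneous tensors -/

namespace IsGammaAlgebra

open TensorProduct

variable {F : Type*} [Field F] {Γ : Type*} [NonAssocRing Γ] [Module F Γ] [IsScalarTower F Γ Γ]
  [SMulCommClass F Γ Γ] {𝒢 : ZMod 2 → Submodule F Γ} (h : IsGammaAlgebra 𝒢) {a b c u v w : Γ}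
  {p q r x y z : B42 F}
include h

section

variable (ha : a ∈ 𝒢 0) (hu : u ∈ 𝒢 1) (hp : p.odd = 0) (hx : x.even = 0)
include ha

theorem associator_tmul_even (hp : p.odd = 0) (hq : q.odd = 0) (hr : r.odd = 0) (b c : Γ) :
    associator (a ⊗ₜ[F] p) (b ⊗ₜ[F] q) (c ⊗ₜ[F] r) = 0 := by
  have h1 : p * q * r = p * (q * r) := by
    have h0 : cayMul F 0 0 = 0 := by
      ext i j
      fin_cases i <;> fin_cases j <;> simp [cayMul]
    ext i j <;> simp [hp, hq, hr, h0, mul_assoc]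
  rw [associator_tmul, h.assoc a ha, h1, sub_self]

include hu hp hx

theorem associator_tmul_one_odd_self :
    associator (a ⊗ₜ[F] p) (a ⊗ₜ[F] p) (u ⊗ₜ[F] x) = 0 ∧
    associator (u ⊗ₜ[F] x) (a ⊗ₜ[F] p) (a ⊗ₜ[F] p) = 0 := by
  obtain ⟨-, h1, -, -, -, -, -, h2, h3, -⟩ := h.products_one_odd ha ha hu
  obtain ⟨i1, i2⟩ := B42.associator_one_odd_self hp hx
  rw [associator_tmul, associator_tmul, h1, h2, h3, ← tmul_sub, ← tmul_sub]
  exact ⟨by rw [← associator, i1, tmul_zero], by rw [← associator, i2, tmul_zero]⟩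

theorem associator_tmul_one_odd (hb : b ∈ 𝒢 0) (hq : q.odd = 0) :
    associator (a ⊗ₜ[F] p) (b ⊗ₜ[F] q) (u ⊗ₜ[F] x) +
      associator (b ⊗ₜ[F] q) (a ⊗ₜ[F] p) (u ⊗ₜ[F] x) = 0 ∧
    associator (a ⊗ₜ[F] p) (u ⊗ₜ[F] x) (b ⊗ₜ[F] q) +
      associator (u ⊗ₜ[F] x) (a ⊗ₜ[F] p) (b ⊗ₜ[F] q) = 0 ∧
    associator (u ⊗ₜ[F] x) (a ⊗ₜ[F] p) (b ⊗ₜ[F] q) +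
      associator (u ⊗ₜ[F] x) (b ⊗ₜ[F] q) (a ⊗ₜ[F] p) = 0 ∧
    associator (a ⊗ₜ[F] p) (b ⊗ₜ[F] q) (u ⊗ₜ[F] x) +
      associator (a ⊗ₜ[F] p) (u ⊗ₜ[F] x) (b ⊗ₜ[F] q) = 0 := by
  obtain ⟨h1, h2, h3, h4, h5, h6, h7, h8, h9, h10, h11⟩ := h.products_one_odd ha hb hu
  obtain ⟨i1, i2, i3, i4⟩ := B42.associator_one_odd hp hq hx
  simp only [associator_tmul, h1, h2, h3, h4, h5, h8, h9, h10, h11, ← tmul_sub, ← tmul_add]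
  refine ⟨?_, ?_, ?_, ?_⟩
  · erw [i1, tmul_zero]
  · erw [i2, tmul_zero]
  · erw [i3, tmul_zero]
  · erw [i4, tmul_zero]

theorem associator_tmul_two_odd (hv : v ∈ 𝒢 1) (hy : y.even = 0) :
    associator (u ⊗ₜ[F] x) (v ⊗ₜ[F] y) (a ⊗ₜ[F] p) +
      associator (v ⊗ₜ[F] y) (u ⊗ₜ[F] x) (a ⊗ₜ[F] p) = 0 ∧
    associator (a ⊗ₜ[F] p) (u ⊗ₜ[F] x) (v ⊗ₜ[F] y) +
      associator (u ⊗ₜ[F] x) (a ⊗ₜ[F] p) (v ⊗ₜ[F] y) = 0 ∧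
    associator (a ⊗ₜ[F] p) (u ⊗ₜ[F] x) (v ⊗ₜ[F] y) +
      associator (a ⊗ₜ[F] p) (v ⊗ₜ[F] y) (u ⊗ₜ[F] x) = 0 ∧
    associator (u ⊗ₜ[F] x) (a ⊗ₜ[F] p) (v ⊗ₜ[F] y) +
      associator (u ⊗ₜ[F] x) (v ⊗ₜ[F] y) (a ⊗ₜ[F] p) = 0 := by
  obtain ⟨h1, h2, h3, h4, h5, h6, h7, h8, h9, h10, h11⟩ := h.products_two_odd ha hu hv
  obtain ⟨i1, i2, i3, i4⟩ := B42.associator_two_odd hp hx hy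
  replace i1 := congrArg ((a * (u * v)) ⊗ₜ[F] ·) i1
  replace i2 := congrArg ((a * (u * v)) ⊗ₜ[F] ·) i2
  replace i3 := congrArg ((a * (u * v)) ⊗ₜ[F] ·) i3
  replace i4 := congrArg ((a * (u * v)) ⊗ₜ[F] ·) i4
  simp only [associator, tmul_add, tmul_sub, tmul_zero] at i1 i2 i3 i4
  simp only [associator_tmul, h1, h2, h3, h4, h5, h6, h7, h10, h11, neg_tmul]
  refine ⟨?_, ?_, ?_, ?_⟩
  · linear_combination (norm := abel) i1
  · linear_combination (norm := abel) i2
  · linear_combination (norm := abel) i3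
  · linear_combination (norm := abel) i4

end

/-- Every coefficient in `Γ` is `± a(u²)`, and `u² = 0` is an axiom also in characteristic 2. -/
theorem associator_tmul_two_odd_self (hu : u ∈ 𝒢 1) (ha : a ∈ 𝒢 0) :
    associator (u ⊗ₜ[F] x) (u ⊗ₜ[F] x) (a ⊗ₜ[F] p) = 0 ∧
    associator (a ⊗ₜ[F] p) (u ⊗ₜ[F] x) (u ⊗ₜ[F] x) = 0 := by
  obtain ⟨h1, -, h2, -⟩ := h.products_two_odd ha hu hu
  rw [associator_tmul, associator_tmul, ← h.comm a ha u hu, h1, h2, h.sq_zero u hu]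
  simp

theorem associator_tmul_three_odd_self (hu : u ∈ 𝒢 1) (hx : x.even = 0)
    (hy : y.even = 0) :
    associator (u ⊗ₜ[F] x) (u ⊗ₜ[F] x) (v ⊗ₜ[F] y) = 0 ∧
    associator (v ⊗ₜ[F] y) (u ⊗ₜ[F] x) (u ⊗ₜ[F] x) = 0 := by
  obtain ⟨i1, i2⟩ := B42.products_two_odd_self hx hy
  rw [associator_tmul, associator_tmul, i1, i2, h.sq_zero u hu]
  simp

theorem associator_tmul_three_odd (hu : u ∈ 𝒢 1) (hv : v ∈ 𝒢 1) (hw : w ∈ 𝒢 1)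
    (hx : x.even = 0) (hy : y.even = 0) (hz : z.even = 0) :
    associator (u ⊗ₜ[F] x) (v ⊗ₜ[F] y) (w ⊗ₜ[F] z) +
      associator (v ⊗ₜ[F] y) (u ⊗ₜ[F] x) (w ⊗ₜ[F] z) = 0 ∧
    associator (u ⊗ₜ[F] x) (v ⊗ₜ[F] y) (w ⊗ₜ[F] z) +
      associator (u ⊗ₜ[F] x) (w ⊗ₜ[F] z) (v ⊗ₜ[F] y) = 0 := by
  obtain ⟨h1, h2, h3, h4, h5, h6, h7, -⟩ := h.products_three_odd hu hv hw
  obtain ⟨i1, i2, i3, i4⟩ := B42.products_three_odd hx hy hz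
  replace i1 := congrArg ((u * v * w) ⊗ₜ[F] ·) i1
  replace i2 := congrArg ((v * w * u) ⊗ₜ[F] ·) i2
  replace i3 := congrArg ((u * v * w) ⊗ₜ[F] ·) i3
  replace i4 := congrArg ((v * w * u) ⊗ₜ[F] ·) i4
  simp only [tmul_add, tmul_sub, tmul_zero] at i1 i2 i3 i4
  simp only [associator_tmul, h1, h4, h5, h6, h7, neg_tmul, add_tmul]
  refine ⟨?_, ?_⟩
  · linear_combination (norm := abel) - i1 - i2
  · linear_combination (norm := abel) i3 + i4

theorem associator_self {s y : Γ ⊗[F] B42 F} (hs : s ∈ homogeneousTensors 𝒢 (B42.grading F))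
    (hy : y ∈ homogeneousTensors 𝒢 (B42.grading F)) :
    associator s s y = 0 ∧ associator y s s = 0 := by
  rcases mem_homogeneousTensors hs with ⟨a, ha, p, hp, rfl⟩ | ⟨a, ha, p, hp, rfl⟩ <;>
    rcases mem_homogeneousTensors hy with ⟨b, hb, q, hq, rfl⟩ | ⟨b, hb, q, hq, rfl⟩ <;>
    simp only [B42.mem_grading_zero, B42.mem_grading_one] at hp hq
  · exact ⟨h.associator_tmul_even ha hp hp hq _ _, h.associator_tmul_even hb hq hp hp _ _⟩
  · exact h.associator_tmul_one_odd_self ha hb hp hq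
  · exact h.associator_tmul_two_odd_self ha hb
  · exact h.associator_tmul_three_odd_self ha hp hq

/-- Eight parity patterns. When `s` and `t` have different parities, each half is an instance with
its own assignment of roles to the three arguments. -/
theorem associator_add_swap {s t y : Γ ⊗[F] B42 F}
    (hs : s ∈ homogeneousTensors 𝒢 (B42.grading F))
    (ht : t ∈ homogeneousTensors 𝒢 (B42.grading F))
    (hy : y ∈ homogeneousTensors 𝒢 (B42.grading F)) :
    associator s t y + associator t s y = 0 ∧ associator y s t + associator y t s = 0 := by
  rcases mem_homogeneousTensors hs with ⟨a, ha, p, hp, rfl⟩ | ⟨a, ha, p, hp, rfl⟩ <;>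
    rcases mem_homogeneousTensors ht with ⟨b, hb, q, hq, rfl⟩ | ⟨b, hb, q, hq, rfl⟩ <;>
    rcases mem_homogeneousTensors hy with ⟨c, hc, r, hr, rfl⟩ | ⟨c, hc, r, hr, rfl⟩ <;>
    simp only [B42.mem_grading_zero, B42.mem_grading_one] at hp hq hr
  · rw [h.associator_tmul_even ha hp hq hr, h.associator_tmul_even hb hq hp hr,
      h.associator_tmul_even hc hr hp hq, h.associator_tmul_even hc hr hq hp, add_zero]
    exact ⟨rfl, rfl⟩
  · obtain ⟨h1, -, h3, -⟩ := h.associator_tmul_one_odd ha hc hp hr hb hq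
    exact ⟨h1, h3⟩
  · obtain ⟨-, h2, -, -⟩ := h.associator_tmul_one_odd ha hb hp hq hc hr
    obtain ⟨-, -, -, h4⟩ := h.associator_tmul_one_odd hc hb hr hq ha hp
    exact ⟨h2, h4⟩
  · obtain ⟨-, h2, -, -⟩ := h.associator_tmul_two_odd ha hb hp hq hc hr
    obtain ⟨-, -, -, h4⟩ := h.associator_tmul_two_odd ha hc hp hr hb hq
    exact ⟨h2, h4⟩
  · obtain ⟨-, h2, -, -⟩ := h.associator_tmul_one_odd hb ha hq hp hc hr
    obtain ⟨-, -, -, h4⟩ := h.associator_tmul_one_odd hc ha hr hp hb hq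
    exact ⟨by rw [add_comm]; exact h2, by rw [add_comm]; exact h4⟩
  · obtain ⟨-, h2, -, -⟩ := h.associator_tmul_two_odd hb ha hq hp hc hr
    obtain ⟨-, -, -, h4⟩ := h.associator_tmul_two_odd hb hc hq hr ha hp
    exact ⟨by rw [add_comm]; exact h2, by rw [add_comm]; exact h4⟩
  · obtain ⟨h1, -, h3, -⟩ := h.associator_tmul_two_odd hc ha hr hp hb hq
    exact ⟨h1, h3⟩
  · exact ⟨(h.associator_tmul_three_odd ha hb hc hp hq hr).1,
      (h.associator_tmul_three_odd hc ha hb hr hp hq).2⟩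

/-- The `Γ`-envelope of `B(4,2)` is an alternative algebra. -/
theorem isAlternative_gammaEnvelope : IsAlternative (gammaEnvelope h) where
  left_alt x y := Subtype.ext (sub_eq_zero.1
    (left_alt_of_span (fun _ hs _ hy => (h.associator_self hs hy).1)
      (fun _ hs _ ht _ hy => (h.associator_add_swap hs ht hy).1)
      ((mem_envelope_iff _ _).1 x.2) ((mem_envelope_iff _ _).1 y.2)))
  right_alt x y := Subtype.ext (sub_eq_zero.1
    (right_alt_of_span (fun _ hs _ hy => (h.associator_self hs hy).2)
      (fun _ hs _ ht _ hy => (h.associator_add_swap hs ht hy).2)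
      ((mem_envelope_iff _ _).1 x.2) ((mem_envelope_iff _ _).1 y.2)))

end IsGammaAlgebra

/-! ### The homomorphism from the envelope of the coordinates to `A` -/

namespace CoordAlgebra

section CoordMap

variable {F : Type*} [Field F] {A : Type*} [NonUnitalNonAssocRing A] [IsAlternative A]
  [Module F A] [IsScalarTower F A A] [SMulCommClass F A A] {e : Fin 2 → Fin 2 → A}

variable (F) in
/-- The map `γ ⊗ b ↦ γ b` from the tensor product of the algebra of coordinates of `A` and `B(4,2)`
to `A`. -/
def coordMap (he : IsMatrixUnits e) : CoordAlgebra F he →ₗ[F] B42 F →ₗ[F] A :=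
  LinearMap.mk₂ F (fun g b => (∑ i, ∑ j, b.even i j • evenCoord e (g.even : A) i j) +
      ∑ k, b.odd k • oddCoord e (g.odd : A) k)
    (by
      intros
      simp only [even_add, odd_add, Submodule.coe_add, evenCoord, oddCoord, add_mul, mul_add,
        Fin.sum_univ_two]
      module)
    (by
      intros
      simp only [even_smul, odd_smul, Submodule.coe_smul, evenCoord, oddCoord, mul_smul_comm,
        smul_mul_assoc, Fin.sum_univ_two]
      module)
    (by
      intros
      simp only [B42.even_add, B42.odd_add, Matrix.add_apply, Pi.add_apply, Fin.sum_univ_two]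
      module)
    (by
      intros
      simp only [B42.even_smul, B42.odd_smul, Matrix.smul_apply, Pi.smul_apply, Fin.sum_univ_two,
        smul_eq_mul]
      module)

variable {he : IsMatrixUnits e}

theorem coordMap_even {g : CoordAlgebra F he} {b : B42 F} (hb : b.odd = 0) :
    coordMap F he g b = b.even 0 0 • evenCoord e (g.even : A) 0 0 +
      b.even 0 1 • evenCoord e (g.even : A) 0 1 + b.even 1 0 • evenCoord e (g.even : A) 1 0 +
      b.even 1 1 • evenCoord e (g.even : A) 1 1 := by
  simp only [coordMap, LinearMap.mk₂_apply, hb, Fin.sum_univ_two, Pi.zero_apply]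
  module

theorem coordMap_odd {g : CoordAlgebra F he} {b : B42 F} (hb : b.even = 0) :
    coordMap F he g b = b.odd 0 • oddCoord e (g.odd : A) 0 +
      b.odd 1 • oddCoord e (g.odd : A) 1 := by
  simp only [coordMap, LinearMap.mk₂_apply, hb, Fin.sum_univ_two, Matrix.zero_apply]
  module

/-- Expanding both sides in matrix units and `m₁, m₂` reduces each parity case to the multiplication
table of `evenCoord` and `oddCoord`. -/
theorem coordMap_mul {i j : ZMod 2} {g g' : CoordAlgebra F he} {b b' : B42 F}
    (hg : g ∈ grading F he i) (hb : b ∈ B42.grading F i) (hg' : g' ∈ grading F he j)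
    (hb' : b' ∈ B42.grading F j) :
    coordMap F he (g * g') (b * b') = coordMap F he g b * coordMap F he g' b' := by
  have hbb := B42.isSuperalgebra.mul_mem hb hb'
  have hij : ∀ i : ZMod 2, i = 0 ∨ i = 1 := by decide
  have h2 : (1 : ZMod 2) + 1 = 0 := by decide
  rcases hij i with rfl | rfl <;> rcases hij j with rfl | rfl <;>
    simp only [add_zero, zero_add, h2, B42.mem_grading_zero, B42.mem_grading_one, mem_grading_zero,
      mem_grading_one] at hg hb hg' hb' hbb
  · rw [coordMap_even hbb, coordMap_even hb, coordMap_even hb']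
    simp only [even_mul, hg, hg', Submodule.coe_zero, mul_zero, add_zero, add_mul, mul_add,
      smul_mul_smul_comm, he.evenCoord_mul_evenCoord g.even.2 g'.even.2, hb, hb',
      B42.even_mul_zero_zero, B42.even_mul_zero_one, B42.even_mul_one_zero, B42.even_mul_one_one,
      Pi.zero_apply, if_true, zero_ne_one, one_ne_zero, if_false]
    module
  · rw [coordMap_odd hbb, coordMap_even hb, coordMap_odd hb']
    simp only [odd_mul, hg, hg', Submodule.coe_zero, mul_zero, add_zero, add_mul, mul_add,
      smul_mul_smul_comm, he.evenCoord_mul_oddCoord g.even.2 g'.odd.2, hb, hb',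
      B42.odd_mul_zero, B42.odd_mul_one, Matrix.zero_apply,
      Pi.zero_apply, if_true, zero_ne_one, one_ne_zero, if_false]
    module
  · rw [coordMap_odd hbb, coordMap_odd hb, coordMap_even hb']
    simp only [odd_mul, hg, hg', Submodule.coe_zero, mul_zero, zero_add, add_mul,
      mul_add, smul_mul_smul_comm, he.oddCoord_mul_evenCoord_diag g'.even.2 g.odd.2,
      he.oddCoord_mul_evenCoord_off g'.even.2 g.odd.2 zero_ne_one,
      he.oddCoord_mul_evenCoord_off g'.even.2 g.odd.2 one_ne_zero, hb, hb',
      B42.odd_mul_zero, B42.odd_mul_one, Matrix.zero_apply,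
      Pi.zero_apply, if_true, zero_ne_one, one_ne_zero, if_false]
    module
  · obtain ⟨h00, h11, h01, h10⟩ := he.oddCoord_mul_oddCoord g.odd.2 g'.odd.2
    rw [coordMap_even hbb, coordMap_odd hb, coordMap_odd hb']
    simp only [even_mul, hg, hg', Submodule.coe_zero, mul_zero, zero_add, add_mul, mul_add,
      smul_mul_smul_comm, h00, h01, h10, h11, hb, hb', B42.even_mul_zero_zero,
      B42.even_mul_zero_one, B42.even_mul_one_zero, B42.even_mul_one_one, Matrix.zero_apply]
    module

end CoordMap

end CoordAlgebra

/-! ### The universal property of the tensor algebra of a bimodule -/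

section Tensor

instance AlgQuot.instIsAlternative {F : Type*} [Field F] {A : Type*} [NonUnitalNonAssocRing A]
    [Module F A] [IsAlternative A] (S : Set A) : IsAlternative (AlgQuot F S) where
  left_alt x y := by
    obtain ⟨a, rfl⟩ := AlgQuot.mkₗ_surjective S x
    obtain ⟨b, rfl⟩ := AlgQuot.mkₗ_surjective S y
    simp only [← AlgQuot.mkₗ_mul, IsAlternative.left_alt]
  right_alt x y := by
    obtain ⟨a, rfl⟩ := AlgQuot.mkₗ_surjective S x
    obtain ⟨b, rfl⟩ := AlgQuot.mkₗ_surjective S y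
    simp only [← AlgQuot.mkₗ_mul, IsAlternative.right_alt]

instance FreeAlternative.instIsAlternative {F W : Type*} [Field F] [AddCommGroup W] [Module F W] :
    IsAlternative (FreeAlternative F W) where
  left_alt x y := by
    obtain ⟨a, rfl⟩ := AlgQuot.mkₗ_surjective _ x
    obtain ⟨b, rfl⟩ := AlgQuot.mkₗ_surjective _ y
    exact (AlgQuot.mkₗ_eq_iff _).2 (subset_idealSpan _ (AltRel.left_alt a b))
  right_alt x y := by
    obtain ⟨a, rfl⟩ := AlgQuot.mkₗ_surjective _ x
    obtain ⟨b, rfl⟩ := AlgQuot.mkₗ_surjective _ y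
    exact (AlgQuot.mkₗ_eq_iff _).2 (subset_idealSpan _ (AltRel.right_alt a b))

variable {F A V : Type*} [Field F] [NonUnitalNonAssocRing A] [Module F A]
  [AddCommGroup V] [Module F V] (M : AltBimodule F A V)

/-- The canonical map from `A ⊕ V` to the tensor algebra. -/
def tensorOf : A × V →ₗ[F] BimodTensorAlgebra M where
  toFun w := AlgQuot.mk F _ (FreeAlternative.of F w)
  map_add' v w := by
    rw [← map_add]
    congr 1
    exact (AlgQuot.mkₗ_eq_iff _).2 (subset_idealSpan _ (AltRel.add v w))
  map_smul' c w := by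
    rw [RingHom.id_apply, ← map_smul]
    congr 1
    exact (AlgQuot.mkₗ_eq_iff _).2 (subset_idealSpan _ (AltRel.smul c w))

theorem tensorOf_mul (a b : A) : tensorOf M (a, 0) * tensorOf M (b, 0) = tensorOf M (a * b, 0) :=
  (AlgQuot.mkₗ_eq_iff _).2 (subset_idealSpan _ (TensorRel.mul a b))

theorem tensorOf_left (a : A) (v : V) :
    tensorOf M (a, 0) * tensorOf M (0, v) = tensorOf M (0, M.left a v) :=
  (AlgQuot.mkₗ_eq_iff _).2 (subset_idealSpan _ (TensorRel.left a v))

theorem tensorOf_right (a : A) (v : V) :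
    tensorOf M (0, v) * tensorOf M (a, 0) = tensorOf M (0, M.right a v) :=
  (AlgQuot.mkₗ_eq_iff _).2 (subset_idealSpan _ (TensorRel.right a v))

variable {C : Type*} [NonUnitalNonAssocRing C] [Module F C] [IsScalarTower F C C]
  [SMulCommClass F C C]

/-- Linearity of `f` and alternativity of `C` give the map on the free alternative algebra; the
three compatibilities kill the bimodule relations. -/
theorem exists_tensor_lift [IsAlternative C] (f : A × V →ₗ[F] C)
    (hm : ∀ a b, f (a, 0) * f (b, 0) = f (a * b, 0))
    (hl : ∀ a v, f (a, 0) * f (0, v) = f (0, M.left a v))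
    (hr : ∀ a v, f (0, v) * f (a, 0) = f (0, M.right a v)) :
    ∃ g : BimodTensorAlgebra M →ₙₐ[F] C, ∀ w, g (tensorOf M w) = f w := by
  let g₀ : FreeNonUnitalNonAssocAlgebra F (A × V) →ₙₐ[F] C :=
    FreeNonUnitalNonAssocAlgebra.lift F f
  have hg₀ : ∀ w, g₀ (FreeNonUnitalNonAssocAlgebra.of F w) = f w := fun w =>
    FreeNonUnitalNonAssocAlgebra.lift_of_apply F _ _
  have h₀ : ∀ r ∈ {r | AltRel F (A × V) r}, g₀ r = 0 := by
    rintro r (⟨v, w⟩ | ⟨c, w⟩ | ⟨x, y⟩ | ⟨x, y⟩)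
    · simp [hg₀]
    · simp [hg₀]
    · simp [IsAlternative.left_alt]
    · simp [IsAlternative.right_alt]
  let g₁ : FreeAlternative F (A × V) →ₙₐ[F] C := AlgQuot.lift g₀ h₀
  have hg₁ : ∀ w, g₁ (FreeAlternative.of F w) = f w := hg₀
  refine ⟨AlgQuot.lift g₁ ?_, hg₁⟩
  rintro r (⟨a, b⟩ | ⟨a, v⟩ | ⟨a, v⟩)
  · rw [map_sub, map_mul, hg₁, hg₁, hg₁, hm, sub_self]
  · rw [map_sub, map_mul, hg₁, hg₁, hg₁, hl, sub_self]
  · rw [map_sub, map_mul, hg₁, hg₁, hg₁, hr, sub_self]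

variable {M} in
theorem tensor_hom_ext {f g : BimodTensorAlgebra M →ₙₐ[F] C}
    (h : ∀ w, f (tensorOf M w) = g (tensorOf M w)) : f = g := by
  have h' : (f.comp (AlgQuot.mk F _)).comp (AlgQuot.mk F _) =
      (g.comp (AlgQuot.mk F _)).comp (AlgQuot.mk F _) :=
    FreeNonUnitalNonAssocAlgebra.hom_ext F h
  ext x
  obtain ⟨x, rfl⟩ := AlgQuot.mkₗ_surjective _ x
  obtain ⟨x, rfl⟩ := AlgQuot.mkₗ_surjective _ x
  exact DFunLike.congr_fun h' x

end Tensor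

section MatrixEntries

variable {F C : Type*} [Field F] [AddCommGroup C] [Module F C]

theorem map_matrix_two (f : M2 F →ₗ[F] C) (a : M2 F) :
    f a = a 0 0 • f (Matrix.single 0 0 1) + a 0 1 • f (Matrix.single 0 1 1) +
      a 1 0 • f (Matrix.single 1 0 1) + a 1 1 • f (Matrix.single 1 1 1) := by
  simp only [← map_smul, ← map_add]
  congr 1
  ext i j
  fin_cases i <;> fin_cases j <;> simp

theorem map_vector_two (f : (Fin 2 → F) →ₗ[F] C) (m : Fin 2 → F) :
    f m = m 0 • f (Pi.single 0 1) + m 1 • f (Pi.single 1 1) := by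
  simp only [← map_smul, ← map_add]
  congr 1
  ext i
  fin_cases i <;> simp

end MatrixEntries

/-! ### The homomorphism from the tensor algebra to the envelope -/

section ToEnvelope

variable {F : Type*} [Field F] {Γ : Type*} [NonAssocRing Γ] [Module F Γ] [IsScalarTower F Γ Γ]
  [SMulCommClass F Γ Γ] {𝒢 : ZMod 2 → Submodule F Γ} (h : IsGammaAlgebra 𝒢)

/-- The map `a ↦ γ ⊗ a` for even `γ`. -/
def envelopeEven (γ : 𝒢 0) : M2 F →ₗ[F] gammaEnvelope h where
  toFun a := ⟨(γ : Γ) ⊗ₜ[F] (⟨a, 0⟩ : B42 F),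
    tmul_mem_envelope _ _ γ.2 (B42.mem_grading_zero.2 rfl)⟩
  map_add' a b := Subtype.ext (by
    change _ = _ ⊗ₜ[F] _ + _ ⊗ₜ[F] _
    rw [← TensorProduct.tmul_add]
    exact congrArg (fun b : B42 F => (γ : Γ) ⊗ₜ[F] b) (B42.ext rfl (add_zero _).symm))
  map_smul' c a := Subtype.ext (by
    change _ = c • _ ⊗ₜ[F] _
    rw [← TensorProduct.tmul_smul]
    exact congrArg (fun b : B42 F => (γ : Γ) ⊗ₜ[F] b) (B42.ext rfl (smul_zero _).symm))

/-- The map `m ↦ u ⊗ m` for odd `u`. -/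
def envelopeOdd (u : 𝒢 1) : (Fin 2 → F) →ₗ[F] gammaEnvelope h where
  toFun m := ⟨(u : Γ) ⊗ₜ[F] (⟨0, m⟩ : B42 F),
    tmul_mem_envelope _ _ u.2 (B42.mem_grading_one.2 rfl)⟩
  map_add' a b := Subtype.ext (by
    change _ = _ ⊗ₜ[F] _ + _ ⊗ₜ[F] _
    rw [← TensorProduct.tmul_add]
    exact congrArg (fun b : B42 F => (u : Γ) ⊗ₜ[F] b) (B42.ext (add_zero _).symm rfl))
  map_smul' c a := Subtype.ext (by
    change _ = c • _ ⊗ₜ[F] _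
    rw [← TensorProduct.tmul_smul]
    exact congrArg (fun b : B42 F => (u : Γ) ⊗ₜ[F] b) (B42.ext (smul_zero _).symm rfl))

theorem cayMul_zero_left (m : Fin 2 → F) : cayMul F 0 m = 0 := by
  ext i j
  fin_cases i <;> fin_cases j <;> simp [cayMul]

theorem cayMul_zero_right (m : Fin 2 → F) : cayMul F m 0 = 0 := by
  ext i j
  fin_cases i <;> fin_cases j <;> simp [cayMul]

theorem envelopeEven_one_mul (γ : 𝒢 0) (a b : M2 F) :
    envelopeEven h ⟨1, h.one_mem⟩ a * envelopeEven h γ b = envelopeEven h γ (a * b) := by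
  apply Subtype.ext
  change (1 : Γ) ⊗ₜ[F] _ * _ ⊗ₜ[F] _ = _ ⊗ₜ[F] _
  rw [Algebra.TensorProduct.tmul_mul_tmul, one_mul]
  congr 1
  ext <;> simp [cayMul_zero_left]

theorem envelopeEven_mul_one (γ : 𝒢 0) (a b : M2 F) :
    envelopeEven h γ b * envelopeEven h ⟨1, h.one_mem⟩ a = envelopeEven h γ (b * a) := by
  apply Subtype.ext
  change _ ⊗ₜ[F] _ * (1 : Γ) ⊗ₜ[F] _ = _ ⊗ₜ[F] _
  rw [Algebra.TensorProduct.tmul_mul_tmul, mul_one]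
  congr 1
  ext <;> simp [cayMul_zero_left]

theorem envelopeEven_one_mul_odd (u : 𝒢 1) (a : M2 F) (m : Fin 2 → F) :
    envelopeEven h ⟨1, h.one_mem⟩ a * envelopeOdd h u m =
      envelopeOdd h u (Matrix.vecMul m a) := by
  apply Subtype.ext
  change (1 : Γ) ⊗ₜ[F] _ * _ ⊗ₜ[F] _ = _ ⊗ₜ[F] _
  rw [Algebra.TensorProduct.tmul_mul_tmul, one_mul]
  congr 1
  ext <;> simp [cayMul_zero_left]

theorem envelopeOdd_mul_one (u : 𝒢 1) (a : M2 F) (m : Fin 2 → F) :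
    envelopeOdd h u m * envelopeEven h ⟨1, h.one_mem⟩ a =
      envelopeOdd h u (Matrix.vecMul m a.adjugate) := by
  apply Subtype.ext
  change _ ⊗ₜ[F] _ * (1 : Γ) ⊗ₜ[F] _ = _ ⊗ₜ[F] _
  rw [Algebra.TensorProduct.tmul_mul_tmul, mul_one]
  congr 1
  ext <;> simp [cayMul_zero_right]

variable (F) in
/-- The bimodule `Reg^{#X₀} ⊕ Cay^{#X₁}`. -/
abbrev regCay (X₀ X₁ : Type*) : AltBimodule F (M2 F) ((X₀ →₀ M2 F) × (X₁ →₀ Fin 2 → F)) :=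
  ((AltBimodule.reg F).copies X₀).prod ((AltBimodule.cay F).copies X₁)

variable {X₀ X₁ : Type*}

theorem regCay_left (a : M2 F) (p : X₀ →₀ M2 F) (q : X₁ →₀ Fin 2 → F) :
    (regCay F X₀ X₁).left a (p, q) = (p.mapRange (fun b => a * b) (mul_zero a),
      q.mapRange (fun m => Matrix.vecMul m a) (Matrix.zero_vecMul a)) := rfl

theorem regCay_right (a : M2 F) (p : X₀ →₀ M2 F) (q : X₁ →₀ Fin 2 → F) :
    (regCay F X₀ X₁).right a (p, q) = (p.mapRange (fun b => b * a) (zero_mul a),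
      q.mapRange (fun m => Matrix.vecMul m a.adjugate) (Matrix.zero_vecMul _)) := rfl

/-- The linear map to the envelope that corresponds to a choice of even elements `g₀ x` and odd
elements `g₁ x`. -/
def toEnvelope (g₀ : X₀ → 𝒢 0) (g₁ : X₁ → 𝒢 1) :
    M2 F × ((X₀ →₀ M2 F) × (X₁ →₀ Fin 2 → F)) →ₗ[F] gammaEnvelope h :=
  (envelopeEven h ⟨1, h.one_mem⟩).coprod
    ((Finsupp.lsum F fun x => envelopeEven h (g₀ x)).coprod
      (Finsupp.lsum F fun x => envelopeOdd h (g₁ x)))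

variable (g₀ : X₀ → 𝒢 0) (g₁ : X₁ → 𝒢 1)

theorem toEnvelope_matrix (a : M2 F) :
    toEnvelope h g₀ g₁ (a, 0) = envelopeEven h ⟨1, h.one_mem⟩ a := by
  simp [toEnvelope]

theorem toEnvelope_reg (x : X₀) (a : M2 F) :
    toEnvelope h g₀ g₁ (0, (Finsupp.single x a, 0)) = envelopeEven h (g₀ x) a := by
  simp [toEnvelope]

theorem toEnvelope_cay (x : X₁) (m : Fin 2 → F) :
    toEnvelope h g₀ g₁ (0, (0, Finsupp.single x m)) = envelopeOdd h (g₁ x) m := by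
  simp [toEnvelope]

theorem bimodule_induction {p : (X₀ →₀ M2 F) × (X₁ →₀ Fin 2 → F) → Prop}
    (add : ∀ v w, p v → p w → p (v + w)) (zero : p 0)
    (reg : ∀ x a, p (Finsupp.single x a, 0)) (cay : ∀ x m, p (0, Finsupp.single x m))
    (v : (X₀ →₀ M2 F) × (X₁ →₀ Fin 2 → F)) : p v := by
  obtain ⟨v, w⟩ := v
  have h1 : p (v, 0) := by
    induction v using Finsupp.induction_linear with
    | zero => exact zero
    | single x a => exact reg x a
    | add f g hf hg => simpa using add _ _ hf hg
  have h2 : p (0, w) := by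
    induction w using Finsupp.induction_linear with
    | zero => exact zero
    | single x a => exact cay x a
    | add f g hf hg => simpa using add _ _ hf hg
  simpa using add _ _ h1 h2

theorem toEnvelope_left (a : M2 F) (v : (X₀ →₀ M2 F) × (X₁ →₀ Fin 2 → F)) :
    toEnvelope h g₀ g₁ (a, 0) * toEnvelope h g₀ g₁ (0, v) =
      toEnvelope h g₀ g₁ (0, (regCay F X₀ X₁).left a v) := by
  induction v using bimodule_induction with
  | add v w hv hw =>
    have e (v w : (X₀ →₀ M2 F) × (X₁ →₀ Fin 2 → F)) :
        ((0, v + w) : M2 F × _) = (0, v) + (0, w) := by simp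
    rw [map_add, e, e, map_add, map_add, mul_add, hv, hw]
  | zero => rw [map_zero, Prod.mk_zero_zero, map_zero, mul_zero]
  | reg x b =>
    rw [regCay_left, Finsupp.mapRange_single, Finsupp.mapRange_zero, toEnvelope_matrix,
      toEnvelope_reg, toEnvelope_reg, envelopeEven_one_mul]
  | cay x m =>
    rw [regCay_left, Finsupp.mapRange_single, Finsupp.mapRange_zero, toEnvelope_matrix,
      toEnvelope_cay, toEnvelope_cay, envelopeEven_one_mul_odd]

theorem toEnvelope_right (a : M2 F) (v : (X₀ →₀ M2 F) × (X₁ →₀ Fin 2 → F)) :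
    toEnvelope h g₀ g₁ (0, v) * toEnvelope h g₀ g₁ (a, 0) =
      toEnvelope h g₀ g₁ (0, (regCay F X₀ X₁).right a v) := by
  induction v using bimodule_induction with
  | add v w hv hw =>
    have e (v w : (X₀ →₀ M2 F) × (X₁ →₀ Fin 2 → F)) :
        ((0, v + w) : M2 F × _) = (0, v) + (0, w) := by simp
    rw [map_add, e, e, map_add, map_add, add_mul, hv, hw]
  | zero => rw [map_zero, Prod.mk_zero_zero, map_zero, zero_mul]
  | reg x b =>
    rw [regCay_right, Finsupp.mapRange_single, Finsupp.mapRange_zero, toEnvelope_matrix,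
      toEnvelope_reg, toEnvelope_reg, envelopeEven_mul_one]
  | cay x m =>
    rw [regCay_right, Finsupp.mapRange_single, Finsupp.mapRange_zero, toEnvelope_matrix,
      toEnvelope_cay, toEnvelope_cay, envelopeOdd_mul_one]

theorem exists_tensor_toEnvelope :
    ∃ ψ : BimodTensorAlgebra (regCay F X₀ X₁) →ₙₐ[F] gammaEnvelope h,
      ∀ w, ψ (tensorOf _ w) = toEnvelope h g₀ g₁ w := by
  have := h.isAlternative_gammaEnvelope
  refine exists_tensor_lift (C := gammaEnvelope h) (regCay F X₀ X₁) (toEnvelope h g₀ g₁)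
    (fun a b => ?_) (toEnvelope_left h g₀ g₁) (toEnvelope_right h g₀ g₁)
  rw [toEnvelope_matrix, toEnvelope_matrix, toEnvelope_matrix, envelopeEven_one_mul]

end ToEnvelope

/-! ### Generation of the envelope -/

section Generation

variable {F : Type*} [Field F]

/-- This makes `γδ ⊗ b` a sum of products `(γ ⊗ b')(δ ⊗ b'')` with parities matching `γ` and `δ`, so
that generation of the envelope follows by induction on words. -/
theorem B42.grading_add_le (i j : ZMod 2) : B42.grading F (i + j) ≤
    Submodule.map₂ (LinearMap.mul F (B42 F)) (B42.grading F i) (B42.grading F j) := by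
  have hij : ∀ i : ZMod 2, i = 0 ∨ i = 1 := by decide
  have h1 : (1 : B42 F) ∈ B42.grading F 0 := B42.mem_grading_zero.2 rfl
  intro c hc
  rcases hij i with rfl | rfl
  · rw [zero_add] at hc
    have := Submodule.apply_mem_map₂ (LinearMap.mul F (B42 F)) h1 hc
    rwa [LinearMap.mul_apply', one_mul] at this
  rcases hij j with rfl | rfl
  · rw [add_zero] at hc
    have := Submodule.apply_mem_map₂ (LinearMap.mul F (B42 F)) hc h1
    rwa [LinearMap.mul_apply', mul_one] at this
  rw [show (1 : ZMod 2) + 1 = 0 by decide, B42.mem_grading_zero] at hc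
  have hm (m n : Fin 2 → F) : (⟨0, m⟩ * ⟨0, n⟩ : B42 F) ∈
      Submodule.map₂ (LinearMap.mul F (B42 F)) (B42.grading F 1) (B42.grading F 1) :=
    Submodule.apply_mem_map₂ (LinearMap.mul F (B42 F)) (B42.mem_grading_one.2 rfl)
      (B42.mem_grading_one.2 rfl)
  -- The matrix units are `e₂₁ = m₁²`, `e₁₂ = -m₂²`, `e₁₁ = -m₁m₂` and `e₂₂ = m₂m₁`.
  have e : c = c.even 1 0 • (⟨0, ![1, 0]⟩ * ⟨0, ![1, 0]⟩) -
      c.even 0 1 • (⟨0, ![0, 1]⟩ * ⟨0, ![0, 1]⟩)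
      - c.even 0 0 • (⟨0, ![1, 0]⟩ * ⟨0, ![0, 1]⟩) +
      c.even 1 1 • (⟨0, ![0, 1]⟩ * ⟨0, ![1, 0]⟩) := by
    apply B42.ext_of_entries <;>
      simp [B42.even_sub, B42.odd_sub, cayMul, hc]
  rw [e]
  exact add_mem (sub_mem (sub_mem (Submodule.smul_mem _ _ (hm _ _))
    (Submodule.smul_mem _ _ (hm _ _))) (Submodule.smul_mem _ _ (hm _ _)))
    (Submodule.smul_mem _ _ (hm _ _))

variable {X₀ X₁ : Type*}

/-- The envelope of the free `Γ`-algebra is generated by `M₂` and the tensor products of the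
generators with `M₂` and `Cay`. -/
theorem envelope_le_of_generators
    {K : NonUnitalSubalgebra F (FreeGamma F X₀ X₁ ⊗[F] B42 F)}
    (h1 : ∀ b ∈ B42.grading F 0, (1 : FreeGamma F X₀ X₁) ⊗ₜ[F] b ∈ K)
    (h₀ : ∀ x : X₀, ∀ b ∈ B42.grading F 0,
      (FreeGamma.ofEven x : FreeGamma F X₀ X₁) ⊗ₜ[F] b ∈ K)
    (h₁ : ∀ x : X₁, ∀ b ∈ B42.grading F 1,
      (FreeGamma.ofOdd x : FreeGamma F X₀ X₁) ⊗ₜ[F] b ∈ K) :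
    gammaEnvelope (FreeGamma.isGammaAlgebra (F := F) (X₀ := X₀) (X₁ := X₁)) ≤ K := by
  have hmul : ∀ (i j : ZMod 2) (γ δ : FreeGamma F X₀ X₁),
      (∀ b ∈ B42.grading F i, γ ⊗ₜ[F] b ∈ K) → (∀ b ∈ B42.grading F j, δ ⊗ₜ[F] b ∈ K) →
      ∀ b ∈ B42.grading F (i + j), (γ * δ) ⊗ₜ[F] b ∈ K := by
    intro i j γ δ hγ hδ b hb
    have hle : Submodule.map₂ (LinearMap.mul F (B42 F)) (B42.grading F i) (B42.grading F j) ≤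
        K.toSubmodule.comap (TensorProduct.mk F _ _ (γ * δ)) := by
      refine Submodule.map₂_le.2 fun b hb c hc => ?_
      change (γ * δ) ⊗ₜ[F] (b * c) ∈ K
      rw [← Algebra.TensorProduct.tmul_mul_tmul]
      exact mul_mem (hγ b hb) (hδ c hc)
    exact hle (B42.grading_add_le i j hb)
  have hword : ∀ w : Word X₀ X₁, ∀ b ∈ B42.grading F (Multiplicative.toAdd (parity w)),
      (AlgQuot.mkₗ F _ (MonoidAlgebra.single w 1) : FreeGamma F X₀ X₁) ⊗ₜ[F] b ∈ K := by
    intro w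
    induction w using WithOne.recOneCoe with
    | one => exact h1
    | coe w =>
      induction w using FreeMagma.recOnMul with
      | ih1 x =>
        rcases x with x | x
        · exact h₀ x
        · exact h₁ x
      | ih2 x y hx hy =>
        have : (MonoidAlgebra.single (((x * y : FreeMagma (X₀ ⊕ X₁))) : Word X₀ X₁) (1 : F)) =
            MonoidAlgebra.single (x : Word X₀ X₁) 1 * MonoidAlgebra.single (y : Word X₀ X₁) 1 := by
          rw [MonoidAlgebra.single_mul_single, one_mul, WithOne.coe_mul]
        rw [this, AlgQuot.mkₗ_mul, WithOne.coe_mul, map_mul, toAdd_mul]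
        exact hmul _ _ _ _ hx hy
  intro t ht
  refine (Submodule.span_le.2 ?_ : _ ≤ K.toSubmodule) ((mem_envelope_iff _ _).1 ht)
  rintro _ ⟨i, _, ⟨γ, hγ, rfl⟩, b, hb, rfl⟩
  have hle : freeGrading F X₀ X₁ i ≤ K.toSubmodule.comap
      (((TensorProduct.mk F (FreeGamma F X₀ X₁) (B42 F)).flip b) ∘ₗ AlgQuot.mkₗ F _) := by
    rw [freeGrading, MonoidAlgebra.supported_eq_span_single, Submodule.span_le]
    rintro _ ⟨w, hw, rfl⟩
    refine hword w b ?_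
    rwa [show parity w = Multiplicative.ofAdd i from hw, toAdd_ofAdd]
  exact hle hγ

end Generation

/-! ### The homomorphism from the envelope to the tensor algebra -/

section ToTensor

variable {F : Type*} [Field F] {X₀ X₁ : Type*}

variable (F X₀ X₁) in
/-- The images of the matrix units in the tensor algebra. -/
def tensorUnit (i j : Fin 2) : BimodTensorAlgebra (regCay F X₀ X₁) :=
  tensorOf _ (Matrix.single i j 1, 0)

theorem isMatrixUnits_tensorUnit : IsMatrixUnits (tensorUnit F X₀ X₁) := by
  intro i j k l
  rw [tensorUnit, tensorUnit, tensorOf_mul]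
  by_cases hjk : j = k
  · subst hjk
    rw [if_pos rfl, Matrix.single_mul_single_same, one_mul, tensorUnit]
  · rw [if_neg hjk, Matrix.single_mul_single_of_ne _ _ _ _ hjk, Prod.mk_zero_zero, map_zero]

variable (X₁) in
/-- The map from a copy of `Reg` to the tensor algebra. -/
def tensorReg (x : X₀) : M2 F →ₗ[F] BimodTensorAlgebra (regCay F X₀ X₁) :=
  tensorOf _ ∘ₗ LinearMap.inr F _ _ ∘ₗ LinearMap.inl F _ _ ∘ₗ Finsupp.lsingle x

variable (X₀) in
/-- The map from a copy of `Cay` to the tensor algebra. -/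
def tensorCay (x : X₁) : (Fin 2 → F) →ₗ[F] BimodTensorAlgebra (regCay F X₀ X₁) :=
  tensorOf _ ∘ₗ LinearMap.inr F _ _ ∘ₗ LinearMap.inr F _ _ ∘ₗ Finsupp.lsingle x

theorem tensorReg_apply (x : X₀) (a : M2 F) :
    tensorReg X₁ x a = tensorOf (regCay F X₀ X₁) (0, (Finsupp.single x a, 0)) := rfl

theorem tensorCay_apply (x : X₁) (m : Fin 2 → F) :
    tensorCay X₀ x m = tensorOf (regCay F X₀ X₁) (0, (0, Finsupp.single x m)) := rfl

theorem tensorUnit_mul_reg (i j : Fin 2) (x : X₀) (a : M2 F) :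
    tensorUnit F X₀ X₁ i j * tensorReg X₁ x a = tensorReg X₁ x (Matrix.single i j 1 * a) := by
  rw [tensorUnit, tensorReg_apply, tensorReg_apply, tensorOf_left, regCay_left,
    Finsupp.mapRange_single, Finsupp.mapRange_zero]

theorem tensorReg_mul_unit (i j : Fin 2) (x : X₀) (a : M2 F) :
    tensorReg X₁ x a * tensorUnit F X₀ X₁ i j = tensorReg X₁ x (a * Matrix.single i j 1) := by
  rw [tensorUnit, tensorReg_apply, tensorReg_apply, tensorOf_right, regCay_right,
    Finsupp.mapRange_single, Finsupp.mapRange_zero]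

theorem tensorUnit_mul_cay (i j : Fin 2) (x : X₁) (m : Fin 2 → F) :
    tensorUnit F X₀ X₁ i j * tensorCay X₀ x m =
      tensorCay X₀ x (Matrix.vecMul m (Matrix.single i j 1)) := by
  rw [tensorUnit, tensorCay_apply, tensorCay_apply, tensorOf_left, regCay_left,
    Finsupp.mapRange_single, Finsupp.mapRange_zero]

theorem tensorCay_mul_unit (i j : Fin 2) (x : X₁) (m : Fin 2 → F) :
    tensorCay X₀ x m * tensorUnit F X₀ X₁ i j =
      tensorCay X₀ x (Matrix.vecMul m (Matrix.single i j 1).adjugate) := by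
  rw [tensorUnit, tensorCay_apply, tensorCay_apply, tensorOf_right, regCay_right,
    Finsupp.mapRange_single, Finsupp.mapRange_zero]

theorem peirce_tensorReg (x : X₀) :
    Peirce (tensorUnit F X₀ X₁) 0 0 (tensorReg X₁ x (Matrix.single 0 0 1)) where
  left k := by
    rw [tensorUnit_mul_reg]
    fin_cases k <;> simp
  right k := by
    rw [tensorReg_mul_unit]
    fin_cases k <;> simp

theorem vecMul_single_single (i j k : Fin 2) :
    Matrix.vecMul (Pi.single k 1) (Matrix.single i j (1 : F)) =
      if i = k then Pi.single j 1 else 0 := by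
  ext l
  fin_cases i <;> fin_cases j <;> fin_cases k <;> fin_cases l <;> simp

theorem vecMul_single_adjugate_diag (i k : Fin 2) :
    Matrix.vecMul (Pi.single k 1) (Matrix.single i i (1 : F)).adjugate =
      if i = k then 0 else Pi.single k 1 := by
  ext l
  fin_cases i <;> fin_cases k <;> fin_cases l <;> simp [Matrix.adjugate_fin_two]

/-- The vector `m₁` of a copy of `Cay` is an odd coordinate: `e₁₁m₁ = m₁ = m₁e₂₂`, and `m₁e₂₁ =
-e₂₁m₁ = 0`. -/
theorem isCayley_tensorCay (x : X₁) :
    IsCayley (tensorUnit F X₀ X₁) (tensorCay X₀ x (Pi.single 0 1)) where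
  peirce.left k := by
    rw [tensorUnit_mul_cay, vecMul_single_single]
    fin_cases k <;> simp
  peirce.right k := by
    rw [tensorCay_mul_unit, vecMul_single_adjugate_diag]
    fin_cases k <;> simp
  mul_unit := by
    have h : Matrix.vecMul (Pi.single 0 1) (Matrix.single (1 : Fin 2) (0 : Fin 2) (1 : F)).adjugate =
        0 := by
      ext l
      fin_cases l <;> simp [Matrix.adjugate_fin_two]
    rw [tensorCay_mul_unit, h, map_zero]

/-- The coordinate of an even generator. -/
def coordEven (x : X₀) : CoordAlgebra F (isMatrixUnits_tensorUnit (F := F) (X₀ := X₀) (X₁ := X₁)) :=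
  ⟨⟨_, peirce_tensorReg x⟩, 0⟩

/-- The coordinate of an odd generator. -/
def coordOdd (x : X₁) : CoordAlgebra F (isMatrixUnits_tensorUnit (F := F) (X₀ := X₀) (X₁ := X₁)) :=
  ⟨0, ⟨_, isCayley_tensorCay x⟩⟩

theorem coordMap_one (a : M2 F) :
    CoordAlgebra.coordMap F (isMatrixUnits_tensorUnit (F := F) (X₀ := X₀) (X₁ := X₁)) 1 ⟨a, 0⟩ =
      tensorOf _ (a, 0) := by
  have h := map_matrix_two ((tensorOf (regCay F X₀ X₁)) ∘ₗ LinearMap.inl F _ _) a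
  simp only [LinearMap.comp_apply, LinearMap.inl_apply] at h
  have he (i j : Fin 2) := isMatrixUnits_tensorUnit (F := F) (X₀ := X₀) (X₁ := X₁) i j
  rw [CoordAlgebra.coordMap_even rfl, h]
  simp only [CoordAlgebra.even_one, evenCoord, he, if_true]
  rfl

theorem coordMap_coordEven (x : X₀) (a : M2 F) :
    CoordAlgebra.coordMap F (isMatrixUnits_tensorUnit (F := F) (X₀ := X₀) (X₁ := X₁))
      (coordEven x) ⟨a, 0⟩ = tensorReg X₁ x a := by
  rw [CoordAlgebra.coordMap_even rfl, map_matrix_two (tensorReg X₁ x) a]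
  simp only [coordEven, evenCoord, tensorUnit_mul_reg, tensorReg_mul_unit,
    Matrix.single_mul_single_same, mul_one]

theorem coordMap_coordOdd (x : X₁) (m : Fin 2 → F) :
    CoordAlgebra.coordMap F (isMatrixUnits_tensorUnit (F := F) (X₀ := X₀) (X₁ := X₁))
      (coordOdd x) ⟨0, m⟩ = tensorCay X₀ x m := by
  rw [CoordAlgebra.coordMap_odd rfl, map_vector_two (tensorCay X₀ x) m]
  simp only [coordOdd, oddCoord, tensorUnit_mul_cay, vecMul_single_single, if_true]

/-- Freeness sends the generators to their coordinates in `M₂[V]`, and `coordMap` evaluates these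
coordinates. The resulting linear map on `Γ ⊗ B(4,2)` is multiplicative on homogeneous tensors
because the map of coefficients preserves parity. -/
theorem exists_envelope_toTensor :
    ∃ φ : gammaEnvelope (FreeGamma.isGammaAlgebra (F := F) (X₀ := X₀) (X₁ := X₁)) →ₙₐ[F]
        BimodTensorAlgebra (regCay F X₀ X₁),
      (∀ a, φ (envelopeEven _ ⟨1, FreeGamma.isGammaAlgebra.one_mem⟩ a) = tensorOf _ (a, 0)) ∧
      (∀ x (hx : FreeGamma.ofEven x ∈ FreeGamma.grading F X₀ X₁ 0) a,
        φ (envelopeEven _ ⟨FreeGamma.ofEven x, hx⟩ a) = tensorReg X₁ x a) ∧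
      ∀ x (hx : FreeGamma.ofOdd x ∈ FreeGamma.grading F X₀ X₁ 1) m,
        φ (envelopeOdd _ ⟨FreeGamma.ofOdd x, hx⟩ m) = tensorCay X₀ x m := by
  obtain ⟨⟨χ, ⟨χ1, χ₀, χ₁⟩, -⟩, hχ⟩ := FreeGamma.existsUnique_hom
    (CoordAlgebra.isGammaAlgebra (F := F)
      (he := isMatrixUnits_tensorUnit (F := F) (X₀ := X₀) (X₁ := X₁)))
    (coordEven (F := F) (X₀ := X₀) (X₁ := X₁)) coordOdd
    (fun _ => CoordAlgebra.mem_grading_zero.2 rfl) (fun _ => CoordAlgebra.mem_grading_one.2 rfl)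
  have hχg := hχ χ χ1 χ₀ χ₁
  let f : FreeGamma F X₀ X₁ ⊗[F] B42 F →ₗ[F] BimodTensorAlgebra (regCay F X₀ X₁) :=
    TensorProduct.lift (CoordAlgebra.coordMap F isMatrixUnits_tensorUnit ∘ₗ
      (χ : FreeGamma F X₀ X₁ →ₗ[F] _))
  have hf : ∀ γ b, f (γ ⊗ₜ b) = CoordAlgebra.coordMap F isMatrixUnits_tensorUnit (χ γ) b :=
    fun _ _ => rfl
  refine ⟨envelopeLift _ _ f ?_, fun a => ?_, fun x hx a => ?_, fun x hx m => ?_⟩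
  · rintro _ ⟨i, γ, hγ, b, hb, rfl⟩ _ ⟨j, δ, hδ, c, hc, rfl⟩
    rw [Algebra.TensorProduct.tmul_mul_tmul, hf, hf, hf, map_mul χ]
    exact CoordAlgebra.coordMap_mul (hχg i γ hγ) hb (hχg j δ hδ) hc
  · change f (_ ⊗ₜ _) = _
    rw [hf, χ1, coordMap_one]
  · change f (_ ⊗ₜ _) = _
    rw [hf, χ₀, coordMap_coordEven]
  · change f (_ ⊗ₜ _) = _
    rw [hf, χ₁, coordMap_coordOdd]

theorem FreeGamma.ofEven_mem (x : X₀) : FreeGamma.ofEven x ∈ FreeGamma.grading F X₀ X₁ 0 := by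
  refine ⟨_, ?_, rfl⟩
  rw [SetLike.mem_coe, freeGrading, MonoidAlgebra.supported_eq_span_single]
  exact Submodule.subset_span ⟨_, rfl, rfl⟩

theorem FreeGamma.ofOdd_mem (x : X₁) : FreeGamma.ofOdd x ∈ FreeGamma.grading F X₀ X₁ 1 := by
  refine ⟨_, ?_, rfl⟩
  rw [SetLike.mem_coe, freeGrading, MonoidAlgebra.supported_eq_span_single]
  exact Submodule.subset_span ⟨_, rfl, rfl⟩

end ToTensor

end GammaAlg

end

/-! ### The two homomorphisms are mutually inverse -/

theorem corollary1 (F : Type*) [Field F] (X₀ X₁ : Type*) :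
    ∃ φ : GammaAlg.gammaEnvelope (GammaAlg.FreeGamma.isGammaAlgebra (F := F) (X₀ := X₀) (X₁ := X₁))
        →ₙₐ[F] GammaAlg.BimodTensorAlgebra
          (((GammaAlg.AltBimodule.reg F).copies X₀).prod ((GammaAlg.AltBimodule.cay F).copies X₁)),
      Function.Bijective φ ∧
        ∀ a : Matrix (Fin 2) (Fin 2) F,
          φ (GammaAlg.matrixToEnvelope GammaAlg.FreeGamma.isGammaAlgebra a) =
            GammaAlg.toTensor
              (((GammaAlg.AltBimodule.reg F).copies X₀).prod
                ((GammaAlg.AltBimodule.cay F).copies X₁)) a := by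
  open GammaAlg in
  obtain ⟨φ, φ1, φ₀, φ₁⟩ := exists_envelope_toTensor (F := F) (X₀ := X₀) (X₁ := X₁)
  let h := FreeGamma.isGammaAlgebra (F := F) (X₀ := X₀) (X₁ := X₁)
  let g₀ (x : X₀) : FreeGamma.grading F X₀ X₁ 0 := ⟨_, FreeGamma.ofEven_mem x⟩
  let g₁ (x : X₁) : FreeGamma.grading F X₀ X₁ 1 := ⟨_, FreeGamma.ofOdd_mem x⟩
  obtain ⟨ψ, hψ⟩ := exists_tensor_toEnvelope h g₀ g₁
  -- Homomorphisms out of `M₂[V]` are determined on `M₂ ⊕ V`, and there by single vectors of the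
  -- copies of `Reg` and `Cay`.
  have hφψ : φ.comp ψ = NonUnitalAlgHom.id F _ := by
    refine tensor_hom_ext fun w => ?_
    change φ (ψ _) = tensorOf _ w
    rw [hψ]
    obtain ⟨a, v⟩ := w
    have hv : φ (toEnvelope h g₀ g₁ (0, v)) = tensorOf _ (0, v) := by
      induction v using bimodule_induction with
      | add v w hv hw =>
        have e : ((0, v + w) : M2 F × _) = (0, v) + (0, w) := by simp
        rw [e, map_add, map_add, map_add, hv, hw]
      | zero => rw [Prod.mk_zero_zero, map_zero, map_zero, map_zero]
      | reg x b => rw [toEnvelope_reg, φ₀, tensorReg_apply]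
      | cay x m => rw [toEnvelope_cay, φ₁, tensorCay_apply]
    have e : (a, v) = (a, 0) + (0, v) := by simp
    rw [e, map_add, map_add, map_add, hv, toEnvelope_matrix, φ1]
  -- Surjectivity of `ψ` replaces a direct check of `ψ ∘ φ = id`. The range is taken inside `Γ ⊗
  -- B(4,2)`, so that it can be compared with the envelope.
  have hψφ : Function.Surjective ψ := by
    intro t
    let K := NonUnitalAlgHom.range ((NonUnitalSubalgebraClass.subtype (gammaEnvelope h)).comp ψ)
    have hK : ∀ w, (toEnvelope h g₀ g₁ w : FreeGamma F X₀ X₁ ⊗[F] B42 F) ∈ K := fun w =>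
      ⟨tensorOf _ w, congrArg Subtype.val (hψ w)⟩
    have hle : gammaEnvelope h ≤ K := by
      refine envelope_le_of_generators (fun b hb => ?_) (fun x b hb => ?_) (fun x b hb => ?_)
      · have e : b = ⟨b.even, 0⟩ := B42.ext rfl (B42.mem_grading_zero.1 hb)
        rw [e]
        have hb' := hK (b.even, 0)
        rw [toEnvelope_matrix] at hb'
        exact hb'
      · have e : b = ⟨b.even, 0⟩ := B42.ext rfl (B42.mem_grading_zero.1 hb)
        rw [e]
        have hb' := hK (0, (Finsupp.single x b.even, 0))
        rw [toEnvelope_reg] at hb'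
        exact hb'
      · have e : b = ⟨0, b.odd⟩ := B42.ext (B42.mem_grading_one.1 hb) rfl
        rw [e]
        have hb' := hK (0, (0, Finsupp.single x b.odd))
        rw [toEnvelope_cay] at hb'
        exact hb'
    obtain ⟨s, hs⟩ := hle t.2
    exact ⟨s, Subtype.ext hs⟩
  have hl : ∀ s, φ (ψ s) = s := fun s => DFunLike.congr_fun hφψ s
  -- `φ` is onto since it has the right inverse `ψ`, and injective since all its arguments are
  -- values of `ψ`.
  refine ⟨φ, ⟨fun x y hxy => ?_, fun s => ⟨ψ s, hl s⟩⟩, φ1⟩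
  obtain ⟨s, rfl⟩ := hψφ x
  obtain ⟨t, rfl⟩ := hψφ y
  rw [hl, hl] at hxy
  rw [hxy]
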